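/- Let $X$ be a (not necessarily proper) Gromov hyperbolic geodesic metric space, with Gromov product $(y,z)_p=\frac12\bigl(d(y,p)+d(z,p)-d(y,z)\bigr)$. Its Gromov boundary $\partial X$ is the set of equivalence classes of sequences $(y_i)\subset X$ with $(y_i,y_j)_p\to\infty$ as $i,j\to\infty$, where $(y_i)\sim(z_i)$ if $(y_i,z_i)_p\to\infty$; the boundary Gromov product is $(\xi,\eta)_p=\sup\liminf_{i,j\to\infty}(y_i,z_j)_p\in[0,\infty]$, the supremum being over all sequences $(y_i)$, $(z_j)$ representing $\xi$, $\eta$. For $\xi\in\partial X$ and $N\ge 0$ put $B_p(\xi,N)=\{\eta\in\partial X : (\eta,\xi)_p>N\}$; these sets form neighbourhood bases for the topology which a visual distance defines on $\partial X$. Isometries of $X$ act on $\partial X$. An isometry $g$ of $X$ is called *hyperbolic* with ordered pair of fixed points $(a,b)$ if the orbits $\{g^nx : n\in\mathbb Z\}$, $x\in X$, are unbounded and $g$ acts on $\partial X$ with north-south dynamics with attracting fixed point $a$ and repelling fixed point $b\neq a$. The latter means that $ga=a$, $gb=b$ and, for every $p\in X$: (1) for every $N\ge 0$ there is an integer $m>0$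 with $g^m(\partial X\setminus B_p(b,N))\subset B_p(a,N)$ and $g^{-m}(\partial X\setminus B_p(a,N))\subset B_p(b,N)$; (2) there is some $N\ge 0$ with $\bigcup_{m\in\mathbb Z}g^m\bigl(\partial X\setminus (B_p(a,N)\cup B_p(b,N))\bigr)=\partial X\setminus\{a,b\}$. An isometric action of a group $\Gamma$ on $X$ is called *weakly acylindrical* if for every $x_0\in X$ and every $m>0$ there are $R>0$ and $c>0$ such that the following holds: if $x,y\in X$ satisfy $d(x,y)\ge R$ and some geodesic from $x$ to $y$ meets the $m$-neighbourhood of $x_0$, then there are at most $c$ elements $g\in\Gamma$ with $d(x,gx)\le m$ and $d(y,gy)\le m$. **Corollary 4.4.** Let $\Gamma$ be a countable group with a weakly acylindrical isometric action on a Gromov hyperbolic geodesic metric space $X$. Let $g_1,\dots,g_k\in\Gamma$ act on $X$ as hyperbolic isometries, with ordered pairs of fixed points $(a_1,b_1),\dots,(a_k,b_k)\in\partial X\times\partial X$. Suppose that the orbits of the $2k$ pairs $(a_1,b_1),\dots,(a_k,b_k),(b_1,a_1),\dots,(b_k,a_k)$ under the diagonal action of $\Gamma$ on $\partial X\times\partial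 X$ are pairwise disjoint. Then for every $(q_1,\dots,q_k)\in\mathbb R^k$ there is a quasimorphism $\varphi$ on $\Gamma$, i.e. a function $\varphi:\Gamma\to\mathbb R$ with $\sup_{g,h\in\Gamma}|\varphi(g)+\varphi(h)-\varphi(gh)|<\infty$, such that $\lim_{\ell\to\infty}\varphi(g_i^\ell)/\ell=q_i$ for every $i\le k$. -/

import Mathlib

open Filter Topology
open scoped ENNReal NNReal

/-! ### Hyperbolic geodesic spaces -/

section Space

variable {X : Type*} [MetricSpace X]

/-- `IsGeodesicSegment x y l γ`: the restriction of `γ` to `[0, l]` is a geodesic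
(an isometric embedding) which connects `x` to `y`. -/
structure IsGeodesicSegment (x y : X) (l : ℝ) (γ : ℝ → X) : Prop where
  length_nonneg : 0 ≤ l
  source : γ 0 = x
  target : γ l = y
  isometry : ∀ s ∈ Set.Icc 0 l, ∀ t ∈ Set.Icc 0 l, dist (γ s) (γ t) = |s - t|

/-- The Gromov product `(y, z)_p` of two points of a metric space. -/
noncomputable def gromovProd (p y z : X) : ℝ :=
  (dist y p + dist z p - dist y z) / 2

end Space

/-- A geodesic metric space: any two points are connected by a geodesic. -/
class GeodesicMetricSpace (X : Type*) [MetricSpace X] : Prop where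
  exists_geodesic : ∀ x y : X, ∃ (l : ℝ) (γ : ℝ → X), IsGeodesicSegment x y l γ

/-- Gromov hyperbolicity of a metric space, by Gromov's four-point condition. -/
class GromovHyperbolicSpace (X : Type*) [MetricSpace X] : Prop where
  exists_delta : ∃ δ : ℝ, ∀ p x y z : X,
    min (gromovProd p x y) (gromovProd p y z) - δ ≤ gromovProd p x z

/-! ### The Gromov boundary -/

/-- The sequences converging to infinity: `(y_i, y_j)_p → ∞` as `i, j → ∞`. Gromov products
with respect to two base points differ by at most the distance of the base points, so it is
the same to ask this for one base point or for all of them. -/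
def GromovSeq (X : Type*) [MetricSpace X] : Type _ :=
  {u : ℕ → X // ∀ p : X,
    Tendsto (fun n : ℕ × ℕ => gromovProd p (u n.1) (u n.2)) atTop atTop}

section Boundary

variable {X : Type*} [MetricSpace X]

theorem gromovProd_comm (p y z : X) : gromovProd p y z = gromovProd p z y := by
  unfold gromovProd
  rw [dist_comm y z]
  ring

/-- Two sequences `y`, `z` converging to infinity are equivalent if `(y_i, z_i)_p → ∞`. -/
def GromovSeq.Equivalent (y z : GromovSeq X) : Prop :=
  ∀ p : X, Tendsto (fun n : ℕ => gromovProd p (y.1 n) (z.1 n)) atTop atTop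

theorem GromovSeq.equivalent_refl (y : GromovSeq X) : y.Equivalent y := by
  intro p
  exact (y.2 p).comp tendsto_atTop_diagonal

theorem GromovSeq.Equivalent.symm {y z : GromovSeq X} (h : y.Equivalent z) :
    z.Equivalent y := by
  intro p
  simpa only [gromovProd_comm] using h p

theorem GromovSeq.Equivalent.trans [GromovHyperbolicSpace X] {x y z : GromovSeq X}
    (h : x.Equivalent y) (h' : y.Equivalent z) : x.Equivalent z := by
  intro p
  obtain ⟨δ, hδ⟩ := GromovHyperbolicSpace.exists_delta (X := X)
  rw [tendsto_atTop]
  intro C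
  filter_upwards [tendsto_atTop.1 (h p) (C + δ), tendsto_atTop.1 (h' p) (C + δ)] with n h1 h2
  have h3 := hδ p (x.1 n) (y.1 n) (z.1 n)
  have h4 := le_min h1 h2
  linarith

/-- The equivalence relation which defines the boundary. -/
def gromovSetoid (X : Type*) [MetricSpace X] [GromovHyperbolicSpace X] :
    Setoid (GromovSeq X) where
  r := GromovSeq.Equivalent
  iseqv := ⟨GromovSeq.equivalent_refl, GromovSeq.Equivalent.symm, GromovSeq.Equivalent.trans⟩

/-- The Gromov boundary of a hyperbolic space. -/
def GromovBoundary (X : Type*) [MetricSpace X] [GromovHyperbolicSpace X] : Type _ :=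
  Quotient (gromovSetoid X)

/-- The boundary point which a sequence converging to infinity defines. -/
def GromovBoundary.mk [GromovHyperbolicSpace X] (y : GromovSeq X) : GromovBoundary X :=
  Quotient.mk (gromovSetoid X) y

/-- The Gromov product on the boundary: the supremum of `liminf (y_i, z_j)_p`, as `i, j → ∞`,
over all sequences `y`, `z` which define `ξ` and `η`. It is infinite for `ξ = η`. -/
noncomputable def boundaryGromovProd [GromovHyperbolicSpace X] (p : X)
    (ξ η : GromovBoundary X) : ℝ≥0∞ :=
  ⨆ (y : GromovSeq X) (z : GromovSeq X)
    (_ : GromovBoundary.mk y = ξ) (_ : GromovBoundary.mk z = η),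
    liminf (fun n : ℕ × ℕ => ENNReal.ofReal (gromovProd p (y.1 n.1) (z.1 n.2))) atTop

/-- The standard neighbourhoods of a boundary point `ξ`: the points `η` with `(η, ξ)_p > N`.
If `d` is a visual distance, so that `d(η, ξ)` agrees with `exp (-χ (η, ξ)_p)` up to a constant
factor, then each ball of `d` about `ξ` contains a set of this form and conversely, with radii
which do not depend on `ξ`. -/
def boundaryNhd [GromovHyperbolicSpace X] (p : X) (ξ : GromovBoundary X) (N : ℝ≥0) :
    Set (GromovBoundary X) :=
  {η | (N : ℝ≥0∞) < boundaryGromovProd p η ξ}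

end Boundary

/-! ### The action of isometries on the boundary -/

section Action

variable {G X : Type*} [Group G] [MetricSpace X] [MulAction G X] [IsIsometricSMul G X]

theorem gromovProd_smul (g : G) (p y z : X) :
    gromovProd p (g • y) (g • z) = gromovProd (g⁻¹ • p) y z := by
  have h (w : X) : dist (g • w) p = dist w (g⁻¹ • p) := by
    rw [← dist_smul g w (g⁻¹ • p), smul_inv_smul]
  unfold gromovProd
  rw [h, h, dist_smul]

/-- Isometries act on the sequences converging to infinity. -/
def GromovSeq.map (g : G) (y : GromovSeq X) : GromovSeq X :=
  ⟨fun n => g • y.1 n, fun p => by simpa only [gromovProd_smul] using y.2 (g⁻¹ • p)⟩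

theorem GromovSeq.Equivalent.map (g : G) {y z : GromovSeq X} (h : y.Equivalent z) :
    (y.map g).Equivalent (z.map g) := by
  intro p
  simpa only [GromovSeq.map, gromovProd_smul] using h (g⁻¹ • p)

/-- The action of a group of isometries on the boundary. -/
instance GromovBoundary.instMulAction [GromovHyperbolicSpace X] :
    MulAction G (GromovBoundary X) where
  smul g := Quotient.map (sa := gromovSetoid X) (sb := gromovSetoid X) (GromovSeq.map g)
    (fun _ _ h => GromovSeq.Equivalent.map g h)
  one_smul ξ := by
    induction ξ using Quotient.inductionOn with
    | _ y =>
      refine congrArg (Quotient.mk (gromovSetoid X)) (Subtype.ext ?_)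
      funext n
      exact one_smul G (y.1 n)
  mul_smul g h ξ := by
    induction ξ using Quotient.inductionOn with
    | _ y =>
      refine congrArg (Quotient.mk (gromovSetoid X)) (Subtype.ext ?_)
      funext n
      exact mul_smul g h (y.1 n)

/-- North-south dynamics of `g` on the boundary, with attracting fixed point `a` and repelling
fixed point `b`. -/
structure HasNorthSouthDynamics [GromovHyperbolicSpace X] (g : G) (a b : GromovBoundary X) :
    Prop where
  ne : a ≠ b
  smul_attracting : g • a = a
  smul_repelling : g • b = b
  contracts : ∀ (p : X) (N : ℝ≥0), ∃ m : ℕ, 0 < m ∧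
    (∀ ξ, ξ ∉ boundaryNhd p b N → g ^ m • ξ ∈ boundaryNhd p a N) ∧
    (∀ ξ, ξ ∉ boundaryNhd p a N → (g ^ m)⁻¹ • ξ ∈ boundaryNhd p b N)
  exhausts : ∀ p : X, ∃ N : ℝ≥0,
    (⋃ m : ℤ, (fun ξ => g ^ m • ξ) '' (boundaryNhd p a N ∪ boundaryNhd p b N)ᶜ) = {a, b}ᶜ

/-- `g` is hyperbolic with ordered pair of fixed points `(a, b)`: it acts on the boundary with
north-south dynamics, and its orbits in `X` are unbounded. The second condition follows from the
first as soon as the boundary has a third point; if the boundary is `{a, b}`, every isometry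
which fixes `a` and `b`, such as the identity, has the first property. -/
structure IsHyperbolicElement [GromovHyperbolicSpace X] (g : G) (a b : GromovBoundary X) :
    Prop where
  northSouth : HasNorthSouthDynamics g a b
  unbounded : ∀ x : X, ¬ Bornology.IsBounded (Set.range fun n : ℤ => g ^ n • x)

end Action

/-- Weakly acylindrical actions: for every point `x₀` and every `m > 0` there are `R > 0` and
`c > 0` such that, if `d(x, y) ≥ R` and some geodesic from `x` to `y` meets the `m`-neighbourhood
of `x₀`, then at most `c` elements of the group move both `x` and `y` by at most `m`. -/
def IsWeaklyAcylindrical (G X : Type*) [Group G] [MetricSpace X] [MulAction G X] : Prop :=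
  ∀ (x₀ : X) (m : ℝ), 0 < m → ∃ (R : ℝ) (c : ℕ), 0 < R ∧ 0 < c ∧
    ∀ x y : X, R ≤ dist x y →
      (∃ (l : ℝ) (γ : ℝ → X), IsGeodesicSegment x y l γ ∧
        ∃ t ∈ Set.Icc 0 l, dist (γ t) x₀ < m) →
      {g : G | dist x (g • x) ≤ m ∧ dist y (g • y) ≤ m}.encard ≤ c

/-- A quasimorphism: a real function on the group whose defect is finite. -/
def IsQuasimorphism {G : Type*} [Group G] (φ : G → ℝ) : Prop :=
  ∃ C : ℝ, ∀ g h : G, |φ g + φ h - φ (g * h)| ≤ C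

/-! The theorem is proved with an asymmetric version of the counting quasimorphisms of Brooks,
Epstein and Fujiwara. Fix a base point `p`. For a given `i` and a large `N`, declare all translates
of the pair `(p, g_i ^ N • p)` to be one-way shortcuts, whose price is by a constant `W` smaller
than their length, and let `D x z` be the least cost of travelling from `x` to `z`
(`shortcutDist`). This is an invariant asymmetric distance with `D ≤ d ≤ 2 D`, and
`φ h = D p (h • p) - D (h • p) p` measures how much more the shortcuts save in one direction than
in the other.

Almost optimal chains of shortcuts and free moves are quasi-geodesics with constants which depend
on `W` only. By the stability of quasi-geodesics, proved here in a discrete form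
(`IsHyperbolicityConstant.exists_forall_step_gromovProd_le`), they pass close to every point of the
geodesic with the same ends, so that `D` is additive along geodesics up to a constant which does
not depend on `N` (`exists_shortcutDist_add_le`). Cutting triangles at their centres shows that
`φ` is a quasimorphism (`isQuasimorphism_shortcutDist_sub`).

An element which fixes two boundary points and has unbounded orbits moves `p` at a linear rate, up
to a bounded error, since the Busemann function of a fixed point is a quasimorphism on its powers
(`exists_isLoxodromicAt`). If `W` exceeds this error for `g_i`, then `D p (g_i ^ n • p)` grows at
a smaller rate than the distance. On the other hand, if an almost optimal chain from `p` to
`g' ^ n • p` uses a shortcut, where `g'` is `g_i⁻¹` or one of the elements `g_j`, `g_j⁻¹` with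
`j ≠ i`, then some translate of the long orbit segment of `g_i` follows the axis of `g'` in the
positive direction. By weak acylindricity and the pigeonhole principle, a positive power of a
conjugate of `g_i` is then a positive power of `g'` (`IsLoxodromicAt.eventually_not_fellowTravel`).
So the conjugating element maps the pair of ends of `g_i` to that of `g'`
(`IsLoxodromicAt.smul_attracting_eq`), which contradicts the disjointness of the orbits. Hence, for
these `g'`, the distances `D` and `d` agree on the pairs `(p, g' ^ n • p)`; thus `φ` vanishes on the
powers of `g_j` for `j ≠ i`, and it grows linearly on those of `g_i`. A linear combination of
these quasimorphisms takes the prescribed values. -/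

/-! ### Gromov products -/

section GromovProduct

variable {X : Type*} [MetricSpace X]

theorem gromovProd_nonneg (p y z : X) : 0 ≤ gromovProd p y z := by
  unfold gromovProd
  linarith [dist_triangle_right y z p]

theorem gromovProd_le_dist_left (p y z : X) : gromovProd p y z ≤ dist p y := by
  unfold gromovProd
  linarith [dist_triangle z y p, dist_comm y z, dist_comm p y]

theorem gromovProd_le_dist_right (p y z : X) : gromovProd p y z ≤ dist p z := by
  rw [gromovProd_comm]
  exact gromovProd_le_dist_left p z y

theorem gromovProd_self (p y : X) : gromovProd p y y = dist p y := by
  unfold gromovProd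
  rw [dist_self, dist_comm y p]
  ring

theorem gromovProd_le_add_dist (p p' y z : X) :
    gromovProd p y z ≤ gromovProd p' y z + dist p p' := by
  unfold gromovProd
  linarith [dist_triangle y p' p, dist_triangle z p' p, dist_comm p p']

theorem gromovProd_le_add_dist_left (p y y' z : X) :
    gromovProd p y z ≤ gromovProd p y' z + dist y y' := by
  unfold gromovProd
  linarith [dist_triangle y y' p, dist_triangle y' y z, dist_comm y y']

theorem gromovProd_le_add_dist_right (p y z z' : X) :
    gromovProd p y z ≤ gromovProd p y z' + dist z z' := by
  rw [gromovProd_comm p y z, gromovProd_comm p y z']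
  exact gromovProd_le_add_dist_left p z z' y

theorem dist_sub_dist_le_gromovProd (p y z : X) : dist p y - dist y z ≤ gromovProd p y z := by
  unfold gromovProd
  linarith [dist_triangle_left y p z, dist_comm p y, dist_triangle y z p]

theorem gromovProd_add_gromovProd (p y z : X) :
    gromovProd p y z + gromovProd y p z = dist p y := by
  unfold gromovProd
  rw [dist_comm y p, dist_comm z p, dist_comm z y]
  ring

/-- If `v` lies between `y` and `y'`, passing from `y` to `v` does not decrease the Gromov
product with `y'`. -/
theorem gromovProd_le_of_between {p y y' v : X} (h : dist y v + dist v y' = dist y y') :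
    gromovProd p y y' ≤ gromovProd p v y' := by
  unfold gromovProd
  linarith [dist_triangle y v p]

/-- The constant `δ` is a hyperbolicity constant of `X`, taken to be positive. -/
structure IsHyperbolicityConstant (X : Type*) [MetricSpace X] (δ : ℝ) : Prop where
  pos : 0 < δ
  four_point : ∀ p x y z : X,
    min (gromovProd p x y) (gromovProd p y z) - δ ≤ gromovProd p x z

theorem exists_isHyperbolicityConstant (X : Type*) [MetricSpace X] [GromovHyperbolicSpace X] :
    ∃ δ : ℝ, IsHyperbolicityConstant X δ := by
  obtain ⟨δ, hδ⟩ := GromovHyperbolicSpace.exists_delta (X := X)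
  refine ⟨max δ 1, by positivity, fun p x y z => ?_⟩
  linarith [hδ p x y z, le_max_left δ 1]

namespace IsHyperbolicityConstant

variable {δ : ℝ} (hδ : IsHyperbolicityConstant X δ)
include hδ

theorem le_gromovProd {p x y z : X} {r : ℝ} (h₁ : r ≤ gromovProd p x y)
    (h₂ : r ≤ gromovProd p y z) : r - δ ≤ gromovProd p x z :=
  (sub_le_sub_right (le_min h₁ h₂) δ).trans (hδ.four_point p x y z)

/-- Two points which are close to a geodesic from `e` to `e'`, and at about the same distance
from `e`, are close to each other. -/
theorem dist_le_of_gromovProd_le {e e' u v : X} {κ : ℝ} (hu : gromovProd u e e' ≤ κ)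
    (hv : gromovProd v e e' ≤ κ) :
    dist u v ≤ |dist e u - dist e v| + 2 * κ + 2 * δ := by
  have h₁ := gromovProd_add_gromovProd e u e'
  have h₂ := gromovProd_add_gromovProd e v e'
  have h₃ : min (dist e u) (dist e v) - κ - δ ≤ gromovProd e u v := by
    refine hδ.le_gromovProd (y := e') ?_ ?_
    · linarith [min_le_left (dist e u) (dist e v)]
    · rw [gromovProd_comm]
      linarith [min_le_right (dist e u) (dist e v)]
  unfold gromovProd at h₃
  rw [dist_comm u e, dist_comm v e] at h₃
  rcases le_total (dist e u) (dist e v) with h | h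
  · rw [min_eq_left h] at h₃
    rw [abs_of_nonpos (by linarith)]
    linarith
  · rw [min_eq_right h] at h₃
    rw [abs_of_nonneg (by linarith)]
    linarith

/-- The standard estimate for a chain of at most `2 ^ k` steps, by repeated halving. -/
theorem exists_step_gromovProd_le (y : X) (k : ℕ) : ∀ (u : ℕ → X) (n : ℕ), 0 < n → n ≤ 2 ^ k →
    ∃ i < n, gromovProd y (u i) (u (i + 1)) ≤ gromovProd y (u 0) (u n) + k * δ := by
  induction k with
  | zero =>
    intro u n hn hn'
    obtain rfl : n = 1 := by simp at hn'; omega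
    exact ⟨0, one_pos, by simp⟩
  | succ k ih =>
    intro u n hn hn'
    have hpos := hδ.pos
    push_cast
    rcases le_or_gt n (2 ^ k) with h | h
    · obtain ⟨i, hi, h'⟩ := ih u n hn h
      exact ⟨i, hi, by linarith⟩
    · have h₁ := hδ.four_point y (u 0) (u (2 ^ k)) (u n)
      rcases min_choice (gromovProd y (u 0) (u (2 ^ k))) (gromovProd y (u (2 ^ k)) (u n))
        with h₂ | h₂
      · obtain ⟨i, hi, h'⟩ := ih u (2 ^ k) (by positivity) le_rfl
        exact ⟨i, hi.trans h, by linarith⟩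
      · obtain ⟨i, hi, h'⟩ := ih (fun j => u (2 ^ k + j)) (n - 2 ^ k) (by omega)
          (by rw [pow_succ] at hn'; omega)
        refine ⟨2 ^ k + i, by omega, ?_⟩
        simp only [add_zero, Nat.add_sub_cancel' h.le] at h'
        rw [add_assoc]
        linarith

end IsHyperbolicityConstant

/-! ### Geodesics and centres of triangles -/

theorem exists_dist_eq_between [GeodesicMetricSpace X] (x z : X) {r : ℝ} (h₀ : 0 ≤ r)
    (h₁ : r ≤ dist x z) : ∃ y, dist x y = r ∧ dist x y + dist y z = dist x z := by
  obtain ⟨l, γ, hγ⟩ := GeodesicMetricSpace.exists_geodesic x z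
  have hl : dist x z = l := by
    rw [← hγ.source, ← hγ.target,
      hγ.isometry 0 ⟨le_rfl, hγ.length_nonneg⟩ l ⟨hγ.length_nonneg, le_rfl⟩, zero_sub, abs_neg,
      abs_of_nonneg hγ.length_nonneg]
  have h₂ : dist x (γ r) = r := by
    rw [← hγ.source, hγ.isometry 0 ⟨le_rfl, hγ.length_nonneg⟩ r ⟨h₀, by linarith⟩, zero_sub,
      abs_neg, abs_of_nonneg h₀]
  have h₃ : dist (γ r) z = l - r := by
    rw [← hγ.target, hγ.isometry r ⟨h₀, by linarith⟩ l ⟨hγ.length_nonneg, le_rfl⟩, abs_sub_comm,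
      abs_of_nonneg (by linarith)]
  exact ⟨γ r, h₂, by linarith⟩

namespace IsHyperbolicityConstant

variable [GeodesicMetricSpace X] {δ : ℝ} (hδ : IsHyperbolicityConstant X δ)
include hδ

theorem exists_between_dist_le (x z y : X) :
    ∃ v, dist x v + dist v z = dist x z ∧ dist y v ≤ gromovProd y x z + 2 * δ := by
  obtain ⟨v, hv, hv'⟩ := exists_dist_eq_between x z (gromovProd_nonneg x y z)
    (gromovProd_le_dist_right x y z)
  refine ⟨v, hv', ?_⟩
  have h₁ := gromovProd_add_gromovProd x y z
  have h₂ : gromovProd x z v = dist x v := by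
    unfold gromovProd
    linarith [dist_comm x z, dist_comm x v, dist_comm v z]
  have h₃ := hδ.le_gromovProd (p := x) (x := y) (y := z) (z := v) le_rfl (by linarith)
  unfold gromovProd at h₁ h₃ ⊢
  rw [dist_comm y x, dist_comm z x] at *
  rw [dist_comm v x] at h₃
  unfold gromovProd at hv
  rw [dist_comm y x, dist_comm z x] at hv
  linarith [dist_comm x z, dist_comm y z]

/-- Geodesic triangles have a coarse centre, which may be taken on one of the sides. -/
theorem exists_center (x y z : X) :
    ∃ o, gromovProd o x y = 0 ∧ gromovProd o x z ≤ δ ∧ gromovProd o y z ≤ δ := by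
  obtain ⟨o, ho, ho'⟩ := exists_dist_eq_between x y (gromovProd_nonneg x y z)
    (gromovProd_le_dist_left x y z)
  have h₀ := hδ.pos
  have key : ∀ x' y' : X, dist x' o + dist o y' = dist x' y' →
      dist x' o = gromovProd x' y' z → gromovProd o x' z ≤ δ := by
    intro x' y' h h'
    have h₁ : gromovProd x' o y' = dist x' o := by
      unfold gromovProd
      linarith [dist_comm o x', dist_comm y' x']
    have h₂ := hδ.le_gromovProd (p := x') (x := o) (y := y') (z := z) h₁.ge h'.le
    have h₃ := gromovProd_add_gromovProd x' o z
    linarith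
  refine ⟨o, ?_, key x y ho' ho, key y x ?_ ?_⟩
  · unfold gromovProd
    linarith [dist_comm o y]
  · linarith [dist_comm o y, dist_comm o x, dist_comm x y]
  · have := gromovProd_add_gromovProd x y z
    linarith [dist_comm o y]

end IsHyperbolicityConstant

end GromovProduct

/-! ### Stability of quasi-geodesic chains -/

section Stability

variable {X : Type*} [MetricSpace X]

theorem exists_forall_linear_le_two_pow (a b : ℝ) : ∃ k₀ : ℕ, ∀ k ≥ k₀, a * k + b ≤ 2 ^ k := by
  have h₁ := (tendsto_pow_const_div_const_pow_of_one_lt 1 (one_lt_two (α := ℝ))).const_mul a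
  have h₂ := (tendsto_pow_const_div_const_pow_of_one_lt 0 (one_lt_two (α := ℝ))).const_mul b
  have h₃ := h₁.add h₂
  simp only [mul_zero, add_zero] at h₃
  obtain ⟨k₀, hk₀⟩ := eventually_atTop.1 (h₃.eventually_le_const one_pos)
  refine ⟨k₀, fun k hk => ?_⟩
  have h₄ := hk₀ k hk
  rw [pow_one, pow_zero, ← mul_div_assoc, ← mul_div_assoc, mul_one, ← add_div,
    div_le_one (by positivity)] at h₄
  exact h₄

theorem between_trans_left {e x' y e' : X} (h : dist e x' + dist x' y = dist e y)
    (hy : dist e y + dist y e' = dist e e') : dist e x' + dist x' e' = dist e e' := by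
  linarith [dist_triangle e x' e', dist_triangle x' y e']

namespace IsHyperbolicityConstant

variable [GeodesicMetricSpace X] {δ : ℝ} (hδ : IsHyperbolicityConstant X δ)
include hδ

/-- If every step of the chain `u` stays away from `y`, while every point between `e` and `y` is
within `M` of some step, then starting from `y` towards `e` one finds a point `x'` at bounded
distance from `y`, and next to it a point `v` of the chain, such that the connection from `x'`
to `v` stays away from `y` as well. -/
theorem exists_detour {u : ℕ → X} {n : ℕ} {M : ℝ} (hM : 0 ≤ M) {e y : X}
    (he : M - 1 < dist y e)
    (hstep : ∃ i < n, dist (u i) e + dist e (u (i + 1)) = dist (u i) (u (i + 1)))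
    (hnear : ∀ x', dist e x' + dist x' y = dist e y →
      ∃ i < n, gromovProd x' (u i) (u (i + 1)) ≤ M) :
    ∃ x' v : X, ∃ i < n, dist e x' + dist x' y = dist e y ∧ dist x' y ≤ 2 * M + 2 * δ ∧
      dist (u i) v + dist v (u (i + 1)) = dist (u i) (u (i + 1)) ∧ dist x' v ≤ M + 2 * δ ∧
      M - 1 < gromovProd y x' v := by
  have hpos := hδ.pos
  rcases le_or_gt (dist y e) (2 * M + 2 * δ) with h | h
  · obtain ⟨i, hi, hie⟩ := hstep
    exact ⟨e, e, i, hi, by simp, by rwa [dist_comm], hie, by simp; positivity,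
      by rwa [gromovProd_self]⟩
  · obtain ⟨x', hx', hx''⟩ := exists_dist_eq_between y e (r := 2 * M + 2 * δ) (by positivity) h.le
    have hx : dist e x' + dist x' y = dist e y := by
      rw [dist_comm e x', dist_comm x' y, dist_comm e y]
      linarith
    obtain ⟨i, hi, h'⟩ := hnear x' hx
    obtain ⟨v, hv, hv'⟩ := hδ.exists_between_dist_le (u i) (u (i + 1)) x'
    refine ⟨x', v, i, hi, hx, by rw [dist_comm]; exact hx'.le, hv, by linarith, ?_⟩
    linarith [dist_sub_dist_le_gromovProd y x' v]

omit [GeodesicMetricSpace X] in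
/-- A lower bound for the Gromov product of two points on steps of a chain which stays away
from `y`. -/
theorem le_gromovProd_of_steps {u : ℕ → X} {n k : ℕ} {y v v' : X} {r : ℝ}
    (hu : ∀ i < n, r ≤ gromovProd y (u i) (u (i + 1))) {i j : ℕ} (hij : i ≤ j) (hj : j < n)
    (hk : j - i ≤ 2 ^ k)
    (hv : dist (u i) v + dist v (u (i + 1)) = dist (u i) (u (i + 1)))
    (hv' : dist (u j) v' + dist v' (u (j + 1)) = dist (u j) (u (j + 1))) :
    r - (k + 2) * δ ≤ gromovProd y v v' := by
  have hpos := hδ.pos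
  have h₁ : r ≤ gromovProd y v (u (i + 1)) :=
    (hu i (by omega)).trans (gromovProd_le_of_between hv)
  have h₂ : r ≤ gromovProd y v' (u j) := by
    refine (hu j hj).trans ?_
    rw [gromovProd_comm]
    refine gromovProd_le_of_between ?_
    linarith [dist_comm v' (u j), dist_comm v' (u (j + 1)), dist_comm (u j) (u (j + 1))]
  have hkδ : 0 ≤ k * δ := by positivity
  rcases hij.eq_or_lt with rfl | hij
  · have h₃ : r ≤ gromovProd y v' (u (i + 1)) := (hu i hj).trans (gromovProd_le_of_between hv')
    rw [gromovProd_comm] at h₃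
    linarith [hδ.le_gromovProd h₁ h₃]
  · have h₃ : r - k * δ ≤ gromovProd y (u (i + 1)) (u j) := by
      rcases Nat.eq_or_lt_of_le hij with h | h
      · rw [show i + 1 = j from h, gromovProd_self]
        linarith [hu j hj, gromovProd_le_dist_left y (u j) (u (j + 1))]
      · obtain ⟨m, hm, h'⟩ := hδ.exists_step_gromovProd_le y k (fun m => u (i + 1 + m))
          (j - (i + 1)) (by omega) (by omega)
        have h₄ := hu (i + 1 + m) (by omega)
        simp only [add_zero, show i + 1 + (j - (i + 1)) = j by omega] at h'
        rw [add_assoc (i + 1) m 1] at h₄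
        linarith
    rw [gromovProd_comm] at h₂
    have h₅ := hδ.le_gromovProd (r := r - k * δ) (by linarith) h₃
      (x := v)
    linarith [hδ.le_gromovProd (r := r - k * δ - δ) h₅ (by linarith)]

/-- Stability of quasi-geodesics, for chains of geodesic segments. If the number of steps between
two points of the chain is bounded by a linear function of their distance, then the chain passes
close to every point between its ends. Closeness to a step is measured by the Gromov product of
its ends. -/
theorem exists_forall_step_gromovProd_le (A B : ℝ) (hA : 0 ≤ A) : ∃ C : ℝ, 0 ≤ C ∧
    ∀ (u : ℕ → X) (n : ℕ), 0 < n →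
      (∀ i j, i < j → j < n → ∀ v v',
        dist (u i) v + dist v (u (i + 1)) = dist (u i) (u (i + 1)) →
        dist (u j) v' + dist v' (u (j + 1)) = dist (u j) (u (j + 1)) →
        (j : ℝ) - i ≤ A * dist v v' + B) →
      ∀ y, dist (u 0) y + dist y (u n) = dist (u 0) (u n) →
        ∃ i < n, gromovProd y (u i) (u (i + 1)) ≤ C := by
  have hpos := hδ.pos
  obtain ⟨k₀, hk₀⟩ := exists_forall_linear_le_two_pow (6 * A * δ)
    (A * (6 * (6 * δ + 1) + 8 * δ) + B)
  refine ⟨(k₀ + 5) * δ + 1, by positivity, fun u n hn hsep y hy => ?_⟩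
  -- `ρ y` measures the distance from `y` to the chain, and `M` is its supremum.
  have hne : (Finset.range n).Nonempty := ⟨0, by simpa using hn⟩
  set ρ : X → ℝ := fun y => (Finset.range n).inf' hne fun i => gromovProd y (u i) (u (i + 1))
    with hρ
  have hρ_le : ∀ y, ∀ i < n, ρ y ≤ gromovProd y (u i) (u (i + 1)) := fun y i hi =>
    Finset.inf'_le _ (by simpa using hi)
  have hρ_eq : ∀ y, ∃ i < n, ρ y = gromovProd y (u i) (u (i + 1)) := fun y => by
    obtain ⟨i, hi, h⟩ := Finset.exists_mem_eq_inf' hne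
      fun i => gromovProd y (u i) (u (i + 1))
    exact ⟨i, by simpa using hi, h⟩
  set S : Set ℝ := ρ '' {y | dist (u 0) y + dist y (u n) = dist (u 0) (u n)} with hS
  have hbdd : BddAbove S := by
    refine ⟨dist (u 0) (u n), ?_⟩
    rintro _ ⟨w, hw, rfl⟩
    have h₁ := hρ_le w 0 hn
    have h₂ := gromovProd_le_dist_left w (u 0) (u (0 + 1))
    have h₃ : dist (u 0) w + dist w (u n) = dist (u 0) (u n) := hw
    linarith [dist_comm w (u 0), dist_nonneg (x := w) (y := u n)]
  have hle : ∀ w, dist (u 0) w + dist w (u n) = dist (u 0) (u n) → ρ w ≤ sSup S :=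
    fun w hw => le_csSup hbdd ⟨w, hw, rfl⟩
  have hnear : ∀ w, dist (u 0) w + dist w (u n) = dist (u 0) (u n) →
      ∃ i < n, gromovProd w (u i) (u (i + 1)) ≤ sSup S := fun w hw => by
    obtain ⟨i, hi, h⟩ := hρ_eq w
    exact ⟨i, hi, h ▸ hle w hw⟩
  suffices hM : sSup S ≤ (k₀ + 5) * δ + 1 by
    obtain ⟨i, hi, h⟩ := hnear y hy
    exact ⟨i, hi, h.trans hM⟩
  by_contra! hlt
  set M := sSup S with hMdef
  have hM0 : 0 ≤ M := le_trans (by positivity) hlt.le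
  obtain ⟨_, ⟨w, hw, rfl⟩, hwM⟩ := exists_lt_of_lt_csSup (s := S) (b := M - 1)
    ⟨_, ⟨y, hy, rfl⟩⟩ (by linarith)
  have hw : dist (u 0) w + dist w (u n) = dist (u 0) (u n) := hw
  have hfar : ∀ i < n, M - 1 ≤ gromovProd w (u i) (u (i + 1)) := fun i hi =>
    hwM.le.trans (hρ_le w i hi)
  -- Leave the geodesic on both sides of `w`, towards the chain.
  obtain ⟨x', v, i, hi, hx, hxR, hv, hxv, hxw⟩ := hδ.exists_detour (u := u) (n := n) hM0
    (e := u 0) (y := w)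
    (hwM.trans_le ((hρ_le w 0 hn).trans (gromovProd_le_dist_left _ _ _)))
    ⟨0, hn, by simp⟩ (fun x' hx' => hnear x' (between_trans_left hx' hw))
  obtain ⟨z', v', j, hj, hz, hzR, hv', hzv, hzw⟩ := hδ.exists_detour (u := u) (n := n) hM0
    (e := u n) (y := w)
    (hwM.trans_le ((hρ_le w (n - 1) (by omega)).trans (by
      have := gromovProd_le_dist_right w (u (n - 1)) (u (n - 1 + 1))
      rwa [Nat.sub_add_cancel (by omega)] at this ⊢)))
    ⟨n - 1, by omega, by rw [Nat.sub_add_cancel (by omega)]; simp⟩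
    (fun x' hx' => hnear x' (by
      have h := between_trans_left hx' (e' := u 0)
        (by linarith [dist_comm (u 0) w, dist_comm w (u n), dist_comm (u 0) (u n)])
      linarith [dist_comm (u 0) x', dist_comm x' (u n), dist_comm (u 0) (u n)]))
  -- The number of steps between the two points of the chain is linear in `M`, so that the
  -- chain between them cannot avoid a ball about `w` with a radius of order `M`.
  have hvv : dist v v' ≤ 6 * M + 8 * δ := by
    linarith [dist_triangle v x' v', dist_triangle x' w v', dist_triangle w z' v',
      dist_comm v x', dist_comm w z']
  have hk : ∃ k : ℕ, k₀ ≤ k ∧ (k + 5) * δ ≤ M - 1 ∧ M - 1 < (k + 6) * δ := by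
    have h₁ : (k₀ : ℝ) + 5 ≤ (M - 1) / δ := by
      rw [le_div_iff₀ hpos]
      linarith
    have h₂ : k₀ + 5 ≤ ⌊(M - 1) / δ⌋₊ := Nat.le_floor (by push_cast; exact h₁)
    refine ⟨⌊(M - 1) / δ⌋₊ - 5, by omega, ?_, ?_⟩
    · rw [← le_div_iff₀ hpos, Nat.cast_sub (by omega)]
      push_cast
      linarith [Nat.floor_le (a := (M - 1) / δ) (by linarith)]
    · rw [← div_lt_iff₀ hpos, Nat.cast_sub (by omega)]
      push_cast
      linarith [Nat.lt_floor_add_one ((M - 1) / δ)]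
  obtain ⟨k, hkk₀, hk₁, hk₂⟩ := hk
  have hsteps : A * (6 * M + 8 * δ) + B ≤ 2 ^ k := by
    refine le_trans ?_ (hk₀ k hkk₀)
    have : A * (6 * M) ≤ A * (6 * ((k + 6) * δ + 1)) := by gcongr; linarith
    linarith
  have hAvv := mul_le_mul_of_nonneg_left hvv hA
  have hmid : M - 1 - (k + 2) * δ ≤ gromovProd w v v' := by
    rcases lt_trichotomy i j with h | rfl | h
    · refine hδ.le_gromovProd_of_steps hfar h.le hj ?_ hv hv'
      have h₁ := hsep i j h hj v v' hv hv'
      have h₂ : ((j - i : ℕ) : ℝ) ≤ 2 ^ k := by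
        rw [Nat.cast_sub h.le]
        linarith
      exact_mod_cast h₂
    · exact hδ.le_gromovProd_of_steps hfar le_rfl hj (by simp) hv hv'
    · rw [gromovProd_comm]
      refine hδ.le_gromovProd_of_steps hfar h.le hi ?_ hv' hv
      have h₁ := hsep j i h hi v' v hv' hv
      have h₂ : ((i - j : ℕ) : ℝ) ≤ 2 ^ k := by
        rw [Nat.cast_sub h.le]
        rw [dist_comm v' v] at h₁
        linarith
      exact_mod_cast h₂
  have hkδ : 0 ≤ k * δ := by positivity
  have h₁ := hδ.le_gromovProd (r := M - 1 - (k + 2) * δ) (by linarith) hmid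
  rw [gromovProd_comm] at hzw
  have h₂ := hδ.four_point w x' v' z'
  have h₃ : gromovProd w x' z' = 0 := by
    unfold gromovProd
    linarith [dist_triangle x' w z', dist_triangle (u 0) x' (u n), dist_triangle x' z' (u n),
      dist_comm (u n) z', dist_comm w z', dist_comm (u n) w]
  rw [h₃] at h₂
  rcases min_choice (gromovProd w x' v') (gromovProd w v' z') with h | h <;> rw [h] at h₂ <;>
    linarith

end IsHyperbolicityConstant

end Stability

/-! ### Distances with one-way shortcuts -/

section Shortcuts

variable {ι X : Type*} [MetricSpace X]

/-- The cost of travelling from `x` to `z` with the help of shortcuts: the shortcut `i` leads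
from `s i` to `t i`, in this direction only, at the price `c`. The list gives the shortcuts used,
in order; between them one moves freely, at the cost of the distance. -/
def chainCost (s t : ι → X) (c : ℝ) : X → List ι → X → ℝ
  | x, [], z => dist x z
  | x, i :: l, z => dist x (s i) + c + chainCost s t c (t i) l z

/-- The points visited by a chain, `2 * l.length + 2` of them. The steps with an even number are
free moves, those with an odd number are shortcuts. -/
def chainNode (s t : ι → X) : X → List ι → X → ℕ → X
  | x, [], _, 0 => x
  | _, [], z, _ + 1 => z
  | x, _ :: _, _, 0 => x
  | _, i :: _, _, 1 => s i
  | _, i :: l, z, k + 2 => chainNode s t (t i) l z k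

/-- The asymmetric distance given by the least cost of a chain from `x` to `z`. -/
noncomputable def shortcutDist (s t : ι → X) (c : ℝ) (x z : X) : ℝ :=
  ⨅ l : List ι, chainCost s t c x l z

/-- Shortcuts of the price `c` which save at most `W`, and at most half of the way. -/
structure IsShortcutFamily (s t : ι → X) (c W : ℝ) : Prop where
  one_le : 1 ≤ c
  nonneg : 0 ≤ W
  le : W ≤ c
  dist_le : ∀ i, dist (s i) (t i) ≤ c + W

omit [MetricSpace X] in
theorem chainNode_zero (s t : ι → X) (x : X) (l : List ι) (z : X) :
    chainNode s t x l z 0 = x := by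
  cases l <;> rfl

omit [MetricSpace X] in
theorem chainNode_last (s t : ι → X) (l : List ι) (z : X) : ∀ x : X,
    chainNode s t x l z (2 * l.length + 1) = z := by
  induction l with
  | nil => exact fun x => rfl
  | cons i l ih => exact fun x => ih (t i)

namespace IsShortcutFamily

variable {s t : ι → X} {c W : ℝ} (h : IsShortcutFamily s t c W)
include h

theorem chainCost_nonneg (l : List ι) (z : X) : ∀ x, 0 ≤ chainCost s t c x l z := by
  induction l with
  | nil => exact fun x => dist_nonneg
  | cons i l ih =>
    intro x
    have := h.one_le
    have := ih (t i)
    simp only [chainCost]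
    positivity

theorem shortcutDist_le_chainCost (x z : X) (l : List ι) :
    shortcutDist s t c x z ≤ chainCost s t c x l z :=
  ciInf_le ⟨0, by rintro _ ⟨l, rfl⟩; exact h.chainCost_nonneg l z x⟩ l

theorem shortcutDist_le_dist (x z : X) : shortcutDist s t c x z ≤ dist x z :=
  h.shortcutDist_le_chainCost x z []

theorem shortcutDist_source_target_le (i : ι) : shortcutDist s t c (s i) (t i) ≤ c := by
  simpa [chainCost] using h.shortcutDist_le_chainCost (s i) (t i) [i]

omit h in
theorem exists_chainCost_lt {x z : X} {r : ℝ} (hr : shortcutDist s t c x z < r) :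
    ∃ l, chainCost s t c x l z < r :=
  exists_lt_of_ciInf_lt hr

omit h in
theorem chainCost_le_dist_add (l : List ι) (x y z : X) :
    chainCost s t c x l z ≤ dist x y + chainCost s t c y l z := by
  cases l with
  | nil => exact dist_triangle x y z
  | cons i l =>
    simp only [chainCost]
    linarith [dist_triangle x y (s i)]

omit h in
theorem chainCost_append_le (l' : List ι) (y z : X) (l : List ι) : ∀ x,
    chainCost s t c x (l ++ l') z ≤ chainCost s t c x l y + chainCost s t c y l' z := by
  induction l with
  | nil => exact fun x => chainCost_le_dist_add l' x y z
  | cons i l ih =>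
    intro x
    simp only [chainCost, List.cons_append]
    linarith [ih (t i)]

theorem shortcutDist_triangle (x y z : X) :
    shortcutDist s t c x z ≤ shortcutDist s t c x y + shortcutDist s t c y z := by
  refine le_of_forall_pos_lt_add fun ε hε => ?_
  obtain ⟨l, hl⟩ := exists_chainCost_lt (lt_add_of_pos_right (shortcutDist s t c x y)
    (half_pos hε))
  obtain ⟨l', hl'⟩ := exists_chainCost_lt (lt_add_of_pos_right (shortcutDist s t c y z)
    (half_pos hε))
  linarith [h.shortcutDist_le_chainCost x z (l ++ l'),
    chainCost_append_le (s := s) (t := t) (c := c) l' y z l x]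

theorem dist_le_two_mul_chainCost (l : List ι) (z : X) : ∀ x,
    dist x z ≤ 2 * chainCost s t c x l z := by
  induction l with
  | nil =>
    intro x
    simp only [chainCost]
    linarith [dist_nonneg (x := x) (y := z)]
  | cons i l ih =>
    intro x
    simp only [chainCost]
    linarith [ih (t i), dist_triangle4 x (s i) (t i) z, h.dist_le i, h.le,
      dist_nonneg (x := x) (y := s i)]

theorem dist_le_two_mul_shortcutDist (x z : X) : dist x z ≤ 2 * shortcutDist s t c x z := by
  have : dist x z / 2 ≤ shortcutDist s t c x z :=
    le_ciInf fun l => by linarith [h.dist_le_two_mul_chainCost l z x]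
  linarith

theorem shortcutDist_le_left (x y z : X) :
    shortcutDist s t c x z ≤ dist x y + shortcutDist s t c y z :=
  (h.shortcutDist_triangle x y z).trans (by gcongr; exact h.shortcutDist_le_dist x y)

theorem shortcutDist_le_right (x y z : X) :
    shortcutDist s t c x z ≤ shortcutDist s t c x y + dist y z :=
  (h.shortcutDist_triangle x y z).trans (by gcongr; exact h.shortcutDist_le_dist y z)

/-- A chain may be left at any step for a detour through a point `y`; this loses the saving of
one shortcut and twice the distance of `y` from the step. -/
theorem shortcutDist_add_le_of_step (y z : X) (l : List ι) : ∀ (x : X) (j : ℕ),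
    j < 2 * l.length + 1 →
    shortcutDist s t c x y + shortcutDist s t c y z ≤ chainCost s t c x l z + W +
      2 * gromovProd y (chainNode s t x l z j) (chainNode s t x l z (j + 1)) := by
  have hW := h.nonneg
  induction l with
  | nil =>
    intro x j hj
    obtain rfl : j = 0 := by simpa using hj
    simp only [chainNode, chainCost, gromovProd]
    linarith [h.shortcutDist_le_dist x y, h.shortcutDist_le_dist y z, dist_comm y z]
  | cons i l ih =>
    intro x j hj
    have hl := h.shortcutDist_le_chainCost (t i) z l
    match j with
    | 0 =>
      simp only [chainNode, chainCost, gromovProd]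
      have h₁ := h.shortcutDist_le_chainCost y z (i :: l)
      simp only [chainCost] at h₁
      linarith [h.shortcutDist_le_dist x y, dist_comm y (s i)]
    | 1 =>
      simp only [chainNode, chainCost, gromovProd, chainNode_zero]
      linarith [h.shortcutDist_le_dist x y, dist_triangle x (s i) y,
        h.shortcutDist_le_left y (t i) z, dist_comm y (t i), h.dist_le i]
    | j + 2 =>
      have h₁ := ih (t i) j (by rw [List.length_cons] at hj; omega)
      simp only [chainNode, chainCost]
      have h₂ := h.shortcutDist_triangle x (t i) y
      have h₃ := h.shortcutDist_le_chainCost x (t i) [i]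
      simp only [chainCost, dist_self, add_zero] at h₃
      linarith

/-- A point on step `j` of a chain is reached after `(j - 1) / 2` shortcuts at least. -/
theorem le_chainCost_of_step (v z : X) (l : List ι) : ∀ (x : X) (j : ℕ), j < 2 * l.length + 1 →
    dist (chainNode s t x l z j) v + dist v (chainNode s t x l z (j + 1)) =
      dist (chainNode s t x l z j) (chainNode s t x l z (j + 1)) →
    ((j : ℝ) - 1) / 2 * c - W + shortcutDist s t c v z ≤ chainCost s t c x l z := by
  have hW := h.nonneg
  have hc := h.one_le
  induction l with
  | nil =>
    intro x j hj hv
    obtain rfl : j = 0 := by simpa using hj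
    simp only [chainNode, chainCost] at hv ⊢
    push_cast
    linarith [h.shortcutDist_le_dist v z, dist_nonneg (x := x) (y := v)]
  | cons i l ih =>
    intro x j hj hv
    have hl := h.shortcutDist_le_chainCost (t i) z l
    match j with
    | 0 =>
      simp only [chainNode, chainCost] at hv ⊢
      have h₁ := h.shortcutDist_le_chainCost v z (i :: l)
      simp only [chainCost] at h₁
      push_cast
      linarith [dist_nonneg (x := x) (y := v)]
    | 1 =>
      simp only [chainNode, chainCost, chainNode_zero] at hv ⊢
      push_cast
      linarith [dist_nonneg (x := x) (y := s i), dist_nonneg (x := s i) (y := v),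
        h.shortcutDist_le_left v (t i) z, h.dist_le i]
    | j + 2 =>
      simp only [chainNode, chainCost] at hv ⊢
      have h₁ := ih (t i) j (by rw [List.length_cons] at hj; omega) hv
      push_cast
      linarith [dist_nonneg (x := x) (y := s i)]

/-- Between two points of a chain, on its steps `j` and `k`, there are about `(k - j) / 2`
shortcuts to be paid. -/
theorem le_chainCost_of_steps (v v' z : X) (l : List ι) : ∀ (x : X) (j k : ℕ), j < k →
    k < 2 * l.length + 1 →
    dist (chainNode s t x l z j) v + dist v (chainNode s t x l z (j + 1)) =
      dist (chainNode s t x l z j) (chainNode s t x l z (j + 1)) →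
    dist (chainNode s t x l z k) v' + dist v' (chainNode s t x l z (k + 1)) =
      dist (chainNode s t x l z k) (chainNode s t x l z (k + 1)) →
    shortcutDist s t c x v + (((k : ℝ) - j) / 2 - 1) * c - 2 * W + shortcutDist s t c v' z ≤
      chainCost s t c x l z := by
  have hW := h.nonneg
  have hc := h.one_le
  induction l with
  | nil =>
    intro x j k hjk hk
    simp at hk
    omega
  | cons i l ih =>
    intro x j k hjk hk hv hv'
    have hl := h.shortcutDist_le_chainCost (t i) z l
    rw [List.length_cons] at hk
    match j, k with
    | 0, 1 =>
      simp only [chainNode, chainCost, chainNode_zero] at hv hv' ⊢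
      push_cast
      linarith [h.shortcutDist_le_dist x v, h.shortcutDist_le_left v' (t i) z,
        dist_nonneg (x := s i) (y := v'), h.dist_le i, dist_nonneg (x := v) (y := s i)]
    | 0, k + 2 =>
      simp only [chainNode, chainCost] at hv hv' ⊢
      have h₁ := h.le_chainCost_of_step v' z l (t i) k (by omega) hv'
      push_cast
      linarith [h.shortcutDist_le_dist x v, dist_nonneg (x := v) (y := s i)]
    | 1, k + 2 =>
      simp only [chainNode, chainCost, chainNode_zero] at hv hv' ⊢
      have h₁ := h.le_chainCost_of_step v' z l (t i) k (by omega) hv'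
      push_cast
      linarith [h.shortcutDist_le_dist x v, dist_triangle x (s i) v,
        dist_nonneg (x := v) (y := t i), h.dist_le i]
    | j + 2, k + 2 =>
      simp only [chainNode, chainCost] at hv hv' ⊢
      have h₁ := ih (t i) j k (by omega) (by omega) hv hv'
      have h₂ := h.shortcutDist_triangle x (t i) v
      have h₃ := h.shortcutDist_le_chainCost x (t i) [i]
      simp only [chainCost, dist_self, add_zero] at h₃
      push_cast
      linarith

end IsShortcutFamily

/-- The shortcut distance is additive along geodesics, up to a constant which depends on the saving
`W`, but not on the price `c` or on the length of the shortcuts. -/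
theorem exists_shortcutDist_add_le (ι : Type*) [GeodesicMetricSpace X] {δ : ℝ}
    (hδ : IsHyperbolicityConstant X δ) {W : ℝ} (hW : 0 ≤ W) : ∃ C : ℝ, 0 ≤ C ∧
      ∀ (s t : ι → X) (c : ℝ), IsShortcutFamily s t c W → ∀ x y z : X,
        shortcutDist s t c x y + shortcutDist s t c y z ≤
          shortcutDist s t c x z + C + 2 * gromovProd y x z := by
  obtain ⟨C, hC, hstab⟩ := hδ.exists_forall_step_gromovProd_le 2 (4 + 4 * W) zero_le_two
  have hpos := hδ.pos
  refine ⟨1 + W + 2 * C + 4 * δ, by positivity, fun s t c h x y z => ?_⟩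
  have hc := h.one_le
  obtain ⟨y', hy', hyy⟩ := hδ.exists_between_dist_le x z y
  obtain ⟨l, hl⟩ := IsShortcutFamily.exists_chainCost_lt
    (lt_add_one (shortcutDist s t c x z))
  obtain ⟨i, hi, hiC⟩ := hstab (chainNode s t x l z) (2 * l.length + 1) (by omega)
    (fun i j hij hj v v' hv hv' => by
      have h₁ := h.le_chainCost_of_steps v v' z l x i j hij hj hv hv'
      have h₂ := h.shortcutDist_triangle x v z
      have h₃ := h.shortcutDist_le_left v v' z
      have h₄ : (((j : ℝ) - i) / 2 - 1) * c ≤ dist v v' + 1 + 2 * W := by linarith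
      by_contra! h₅
      have h₆ : dist v v' + 1 + 2 * W < ((j : ℝ) - i) / 2 - 1 := by linarith
      have h₇ := le_mul_of_one_le_right
        (a := ((j : ℝ) - i) / 2 - 1) (by linarith [dist_nonneg (x := v) (y := v')]) hc
      linarith)
    y' (by rwa [chainNode_zero, chainNode_last])
  have h₁ := h.shortcutDist_add_le_of_step y' z l x i hi
  have h₂ := h.shortcutDist_le_right x y' y
  have h₃ := h.shortcutDist_le_left y y' z
  rw [dist_comm y' y] at h₂
  linarith

/-- A point through which one can travel at almost no additional cost is close to the geodesic. -/
theorem IsShortcutFamily.gromovProd_le [GeodesicMetricSpace X] {δ : ℝ}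
    (hδ : IsHyperbolicityConstant X δ) {s t : ι → X} {c W C : ℝ} (h : IsShortcutFamily s t c W)
    (hC : ∀ x y z : X, shortcutDist s t c x y + shortcutDist s t c y z ≤
      shortcutDist s t c x z + C + 2 * gromovProd y x z) {x u z : X} {r : ℝ}
    (hu : shortcutDist s t c x u + shortcutDist s t c u z ≤ shortcutDist s t c x z + r) :
    gromovProd u x z ≤ 2 * C + r + 5 * δ := by
  obtain ⟨o, h₁, h₂, h₃⟩ := hδ.exists_center x u z
  have h₄ := hC x o u
  have h₅ := hC u o z
  have h₆ := h.shortcutDist_triangle x o z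
  have h₇ := h.dist_le_two_mul_shortcutDist u o
  have h₈ := h.dist_le_two_mul_shortcutDist o u
  have h₉ := gromovProd_le_add_dist u o x z
  have h₁₀ := gromovProd_nonneg o x u
  rw [dist_comm o u] at h₈
  linarith [hδ.pos]

/-- The antisymmetrization of the shortcut distance is coarsely additive on all triangles. -/
theorem IsShortcutFamily.abs_sub_add_sub_le [GeodesicMetricSpace X] {δ : ℝ}
    (hδ : IsHyperbolicityConstant X δ) {s t : ι → X} {c W C : ℝ} (h : IsShortcutFamily s t c W)
    (hC : ∀ x y z : X, shortcutDist s t c x y + shortcutDist s t c y z ≤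
      shortcutDist s t c x z + C + 2 * gromovProd y x z) (x y z : X) :
    |(shortcutDist s t c x y - shortcutDist s t c y x) +
      (shortcutDist s t c y z - shortcutDist s t c z y) -
      (shortcutDist s t c x z - shortcutDist s t c z x)| ≤ 3 * (C + 2 * δ) := by
  have hpos := hδ.pos
  obtain ⟨o, h₁, h₂, h₃⟩ := hδ.exists_center x y z
  have key : ∀ a b : X, gromovProd o a b ≤ δ →
      |(shortcutDist s t c a b - shortcutDist s t c b a) -
        (shortcutDist s t c a o - shortcutDist s t c o a) -
        (shortcutDist s t c o b - shortcutDist s t c b o)| ≤ C + 2 * δ := by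
    intro a b hab
    have h₄ := hC a o b
    have h₅ := hC b o a
    rw [gromovProd_comm] at h₅
    rw [abs_le]
    constructor <;> linarith [h.shortcutDist_triangle a o b, h.shortcutDist_triangle b o a]
  have h₄ := abs_le.1 (key x y (by linarith))
  have h₅ := abs_le.1 (key y z h₃)
  have h₆ := abs_le.1 (key x z h₂)
  rw [abs_le]
  constructor <;> linarith

end Shortcuts

/-! ### Loxodromic elements and weak acylindricity -/

section Loxodromic

variable {G X : Type*} [Group G] [MetricSpace X] [MulAction G X] [IsIsometricSMul G X]

theorem gromovProd_smul_smul_smul (g : G) (p y z : X) :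
    gromovProd (g • p) (g • y) (g • z) = gromovProd p y z := by
  rw [gromovProd_smul, inv_smul_smul]

/-- The distance of `p` from `g ^ n • p` is `n * σ` up to the additive error `C`, and the
translation length `σ` is positive. -/
structure IsLoxodromicAt (g : G) (p : X) (σ C : ℝ) : Prop where
  pos : 0 < σ
  nonneg : 0 ≤ C
  abs_dist_sub_le : ∀ n : ℕ, |dist p (g ^ n • p) - n * σ| ≤ C

theorem dist_pow_smul_pow_smul (g : G) (p : X) {m n : ℕ} (h : m ≤ n) :
    dist (g ^ m • p) (g ^ n • p) = dist p (g ^ (n - m) • p) := by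
  rw [← dist_smul (g ^ m) p, smul_smul, ← pow_add, Nat.add_sub_cancel' h]

theorem dist_inv_pow_smul (g : G) (p : X) (n : ℕ) :
    dist p (g⁻¹ ^ n • p) = dist p (g ^ n • p) := by
  rw [← dist_smul (g ^ n) p, inv_pow, smul_inv_smul, dist_comm]

namespace IsLoxodromicAt

variable {g : G} {p : X} {σ C : ℝ} (hg : IsLoxodromicAt g p σ C)
include hg

theorem inv : IsLoxodromicAt g⁻¹ p σ C :=
  ⟨hg.pos, hg.nonneg, fun n => by rw [dist_inv_pow_smul]; exact hg.abs_dist_sub_le n⟩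

omit [IsIsometricSMul G X] in
theorem le_dist (n : ℕ) : n * σ - C ≤ dist p (g ^ n • p) := by
  linarith [(abs_le.1 (hg.abs_dist_sub_le n)).1]

omit [IsIsometricSMul G X] in
theorem dist_le (n : ℕ) : dist p (g ^ n • p) ≤ n * σ + C := by
  linarith [(abs_le.1 (hg.abs_dist_sub_le n)).2]

omit [IsIsometricSMul G X] in
theorem tendsto_dist : Tendsto (fun n : ℕ => dist p (g ^ n • p)) atTop atTop := by
  refine tendsto_atTop_mono hg.le_dist ?_
  exact tendsto_atTop_add_const_right _ _ (tendsto_natCast_atTop_atTop.atTop_mul_const hg.pos)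

theorem gromovProd_pow_smul_le {k n : ℕ} (h : k ≤ n) :
    gromovProd (g ^ k • p) p (g ^ n • p) ≤ 2 * C := by
  have h₁ := hg.dist_le k
  have h₂ := hg.dist_le (n - k)
  have h₃ := hg.le_dist n
  have h₄ := hg.nonneg
  unfold gromovProd
  rw [dist_comm (g ^ n • p) (g ^ k • p), dist_pow_smul_pow_smul g p h]
  rw [Nat.cast_sub h] at h₂
  linarith

omit [IsIsometricSMul G X] in
theorem pow_ne_one {n : ℕ} (hn : 0 < n) : g ^ n ≠ 1 := by
  intro h
  obtain ⟨m, hm⟩ := exists_nat_gt (C / σ)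
  rw [div_lt_iff₀ hg.pos] at hm
  have h₁ := hg.le_dist (n * m)
  rw [pow_mul, h, one_pow, one_smul, dist_self] at h₁
  have h₂ : (m : ℝ) ≤ (n * m : ℕ) := by exact_mod_cast Nat.le_mul_of_pos_left m hn
  have := mul_le_mul_of_nonneg_right h₂ hg.pos.le
  linarith

/-- The points close to the orbit segment from `p` to `g ^ n • p`, as measured by the Gromov
product, are close to one of the points of this segment. -/
theorem exists_dist_pow_smul_le {δ : ℝ} (hδ : IsHyperbolicityConstant X δ) {u : X} {n : ℕ}
    {K : ℝ} (hK : 0 ≤ K) (hu : gromovProd u p (g ^ n • p) ≤ K) :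
    ∃ i ≤ n, dist u (g ^ i • p) ≤ σ + 5 * C + 4 * K + 2 * δ := by
  have hσ := hg.pos
  have hC := hg.nonneg
  have key : ∀ i ≤ n, |dist p u - dist p (g ^ i • p)| ≤ σ + C + 2 * K →
      dist u (g ^ i • p) ≤ σ + 5 * C + 4 * K + 2 * δ := fun i hi h => by
    have := hδ.dist_le_of_gromovProd_le (e := p) (e' := g ^ n • p) (u := u) (v := g ^ i • p)
      (κ := K + 2 * C) (by linarith) (by linarith [hg.gromovProd_pow_smul_le hi])
    linarith
  have hfloor := Nat.floor_le (a := dist p u / σ) (by positivity)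
  have hfloor' := Nat.lt_floor_add_one (dist p u / σ)
  rw [le_div_iff₀ hσ] at hfloor
  rw [div_lt_iff₀ hσ] at hfloor'
  rcases le_total ⌊dist p u / σ⌋₊ n with h | h
  · refine ⟨_, h, key _ h (abs_le.2 ⟨?_, ?_⟩)⟩
    · linarith [hg.dist_le ⌊dist p u / σ⌋₊]
    · linarith [hg.le_dist ⌊dist p u / σ⌋₊]
  · refine ⟨n, le_rfl, key n le_rfl (abs_le.2 ⟨?_, ?_⟩)⟩
    · have h₁ : (n : ℝ) * σ ≤ ⌊dist p u / σ⌋₊ * σ := by gcongr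
      linarith [hg.dist_le n]
    · unfold gromovProd at hu
      linarith [dist_comm p u, dist_nonneg (x := g ^ n • p) (y := u)]

/-- If a translate by `h` of a long orbit segment of `g` starts and ends close to an orbit segment
of `g'`, then a positive power of `h * g * h⁻¹` is a positive power of `g'`. Indeed, the elements
`g' ^ (-r') * (h * g * h⁻¹) ^ r`, where `r'` is chosen such that the two translations cancel, move
two distant points by a bounded amount, so that two of them agree. -/
theorem eventually_not_fellowTravel [GeodesicMetricSpace X] {δ : ℝ}
    (hδ : IsHyperbolicityConstant X δ) (hG : IsWeaklyAcylindrical G X) {g' : G} {σ' C' : ℝ}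
    (hg' : IsLoxodromicAt g' p σ' C')
    (hne : ∀ (h : G) (m n : ℕ), 0 < m → 0 < n → (h * g * h⁻¹) ^ m ≠ g' ^ n) (B : ℝ) :
    ∀ᶠ N : ℕ in atTop, ∀ (h : G) (j : ℕ), dist (h • p) p ≤ B →
      ¬ dist (h • g ^ N • p) (g' ^ j • p) ≤ B := by
  rcases lt_or_ge B 0 with hB | hB
  · exact Eventually.of_forall fun N h j h₁ => absurd (dist_nonneg.trans h₁) (by linarith)
  have hσ := hg.pos
  have hσ' := hg'.pos
  have hC := hg.nonneg
  have hC' := hg'.nonneg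
  have hpos := hδ.pos
  set B' : ℝ := 5 * C + 5 * C' + 5 * B + 2 * σ' + 2 * δ with hB'
  obtain ⟨R, c, -, -, hacyl⟩ := hG p (2 * B' + B + 1) (by positivity)
  obtain ⟨M, hM⟩ := exists_nat_gt ((R + C + B) / σ)
  rw [div_lt_iff₀ hσ] at hM
  obtain ⟨N₀, hN₀⟩ := exists_nat_gt ((C + C' + 2 * B) / σ)
  rw [div_lt_iff₀ hσ] at hN₀
  filter_upwards [eventually_ge_atTop (M + c + N₀)] with N hN h j hstart hend
  have hNM : ((M : ℝ) + c + N₀) * σ ≤ N * σ := by gcongr; exact_mod_cast hN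
  -- Corresponding points of the two orbit segments are close to each other.
  have hclose : ∀ m ≤ N, ∀ m' ≤ j, |m * σ - m' * σ'| ≤ 2 * σ' →
      dist (h • g ^ m • p) (g' ^ m' • p) ≤ B' := by
    intro m hm m' hm' hmm
    have h₁ : gromovProd (h • g ^ m • p) p (g' ^ j • p) ≤ 2 * C + 2 * B := by
      have h₂ := gromovProd_le_add_dist_left (h • g ^ m • p) p (h • p) (g' ^ j • p)
      have h₃ := gromovProd_le_add_dist_right (h • g ^ m • p) (h • p) (g' ^ j • p)
        (h • g ^ N • p)
      rw [gromovProd_smul_smul_smul] at h₃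
      linarith [hg.gromovProd_pow_smul_le hm, dist_comm p (h • p),
        dist_comm (h • g ^ N • p) (g' ^ j • p)]
    have h₂ := hδ.dist_le_of_gromovProd_le (e := p) (e' := g' ^ j • p) (κ := 2 * C + 2 * C' + 2 * B)
      (u := h • g ^ m • p) (v := g' ^ m' • p) (by linarith)
      (by linarith [hg'.gromovProd_pow_smul_le hm'])
    have h₃ : |dist p (h • g ^ m • p) - dist p (g' ^ m' • p)| ≤ B + C + C' + 2 * σ' := by
      have h₄ : dist (h • p) (h • g ^ m • p) = dist p (g ^ m • p) := dist_smul _ _ _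
      rw [abs_le] at hmm ⊢
      constructor <;>
      linarith [dist_triangle p (h • p) (h • g ^ m • p), dist_triangle (h • p) p (h • g ^ m • p),
        dist_comm p (h • p), hg.dist_le m, hg.le_dist m, hg'.dist_le m', hg'.le_dist m']
    linarith
  have hj : ((M : ℝ) + c) * σ ≤ j * σ' := by
    have h₁ : dist (h • p) (h • g ^ N • p) = dist p (g ^ N • p) := dist_smul _ _ _
    linarith [hg.le_dist N, hg'.dist_le j, dist_triangle4 (h • p) p (g' ^ j • p) (h • g ^ N • p),
      dist_comm (h • g ^ N • p) (g' ^ j • p)]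
  set e : ℕ → ℕ := fun r => ⌊r * σ / σ'⌋₊ with he
  have he_le : ∀ r, e r * σ' ≤ r * σ := fun r => by
    rw [← le_div_iff₀ hσ']
    exact Nat.floor_le (by positivity)
  have he_lt : ∀ r, r * σ < e r * σ' + σ' := fun r => by
    have := Nat.lt_floor_add_one (r * σ / σ')
    rw [div_lt_iff₀ hσ'] at this
    linarith
  set f : G := h * g * h⁻¹ with hf
  have hfpow : ∀ r, f ^ r = h * g ^ r * h⁻¹ := fun r => conj_pow
  have hmaps : Set.MapsTo (fun r => (g' ^ e r)⁻¹ * f ^ r) (Finset.range (c + 1) : Set ℕ)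
      {k : G | dist p (k • p) ≤ 2 * B' + B + 1 ∧
        dist (h • g ^ M • p) (k • h • g ^ M • p) ≤ 2 * B' + B + 1} := by
    intro r hr
    have hr : r ≤ c := by simpa [Nat.lt_succ_iff] using hr
    have hrσ : (r : ℝ) * σ ≤ c * σ := by gcongr
    have hej : e r + e M ≤ j := by
      have h₁ : ((e r + e M : ℕ) : ℝ) * σ' ≤ j * σ' := by
        push_cast
        linarith [he_le r, he_le M]
      exact_mod_cast le_of_mul_le_mul_right h₁ hσ'
    change dist p (((g' ^ e r)⁻¹ * f ^ r) • p) ≤ _ ∧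
      dist _ (((g' ^ e r)⁻¹ * f ^ r) • h • g ^ M • p) ≤ _
    constructor
    · rw [← dist_smul (g' ^ e r), smul_smul, mul_inv_cancel_left, hfpow, mul_smul, mul_smul]
      have h₁ := hclose r (by omega) (e r) (by omega)
        (abs_le.2 ⟨by linarith [he_le r], by linarith [he_lt r]⟩)
      have h₂ : dist (h • g ^ r • p) (h • g ^ r • h⁻¹ • p) = dist (h • p) p := by
        rw [dist_smul, dist_smul, ← dist_smul h, smul_inv_smul]
      linarith [dist_triangle (g' ^ e r • p) (h • g ^ r • p) (h • g ^ r • h⁻¹ • p),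
        dist_comm (g' ^ e r • p) (h • g ^ r • p)]
    · have h₁ := hclose M (by omega) (e M) (by omega)
        (abs_le.2 ⟨by linarith [he_le M], by linarith [he_lt M]⟩)
      have h₂ := hclose (r + M) (by omega) (e r + e M) hej (abs_le.2 (by
        push_cast
        constructor <;> linarith [he_le r, he_lt r, he_le M, he_lt M]))
      have h₃ : dist (h • g ^ M • p) (((g' ^ e r)⁻¹ * f ^ r) • h • g ^ M • p) =
          dist (g' ^ e r • h • g ^ M • p) (h • g ^ (r + M) • p) := by
        rw [← dist_smul (g' ^ e r), hfpow, pow_add]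
        simp only [smul_smul]
        congr 2
        group
      have h₄ : dist (g' ^ e r • h • g ^ M • p) (g' ^ (e r + e M) • p) =
          dist (h • g ^ M • p) (g' ^ e M • p) := by
        rw [pow_add, mul_smul, dist_smul]
      rw [h₃]
      linarith [dist_triangle (g' ^ e r • h • g ^ M • p) (g' ^ (e r + e M) • p)
        (h • g ^ (r + M) • p), dist_comm (g' ^ (e r + e M) • p) (h • g ^ (r + M) • p)]
  have hdist : R ≤ dist p (h • g ^ M • p) := by
    have h₁ : dist (h • p) (h • g ^ M • p) = dist p (g ^ M • p) := dist_smul _ _ _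
    linarith [dist_triangle (h • p) p (h • g ^ M • p), hg.le_dist M]
  obtain ⟨l, γ, hγ⟩ := GeodesicMetricSpace.exists_geodesic p (h • g ^ M • p)
  have hcard := hacyl p (h • g ^ M • p) hdist
    ⟨l, γ, hγ, 0, ⟨le_rfl, hγ.length_nonneg⟩, by rw [hγ.source, dist_self]; positivity⟩
  have hnotinj : ¬ Set.InjOn (fun r => (g' ^ e r)⁻¹ * f ^ r)
      (Finset.range (c + 1) : Set ℕ) := fun hinj => by
    have h₁ : ((fun r => (g' ^ e r)⁻¹ * f ^ r) '' (Finset.range (c + 1) : Set ℕ)).encard ≤ c :=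
      (Set.encard_le_encard hmaps.image_subset).trans hcard
    rw [hinj.encard_image, Set.encard_coe_eq_coe_finsetCard, Finset.card_range] at h₁
    have h₂ : c + 1 ≤ c := by exact_mod_cast h₁
    omega
  have hcoll : ∃ r s : ℕ, s < r ∧ (g' ^ e r)⁻¹ * f ^ r = (g' ^ e s)⁻¹ * f ^ s := by
    simp only [Set.InjOn, not_forall] at hnotinj
    obtain ⟨r, _, s, _, hrs, hrs'⟩ := hnotinj
    rcases lt_or_gt_of_ne hrs' with hlt | hlt
    · exact ⟨s, r, hlt, hrs.symm⟩
    · exact ⟨r, s, hlt, hrs⟩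
  obtain ⟨r, s, hsr, hrs⟩ := hcoll
  have hes : e s ≤ e r := Nat.floor_le_floor (by gcongr)
  obtain ⟨m, rfl⟩ := Nat.exists_eq_add_of_lt hsr
  obtain ⟨n, hn⟩ := Nat.exists_eq_add_of_le hes
  have hfg : f ^ (m + 1) = g' ^ n := by
    rw [hn, add_comm (e s) n, pow_add g', add_assoc, add_comm s (m + 1), pow_add f, mul_inv_rev,
      mul_assoc, mul_right_inj, ← mul_assoc, mul_eq_right, inv_mul_eq_one] at hrs
    exact hrs.symm
  rcases Nat.eq_zero_or_pos n with rfl | hn0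
  · rw [pow_zero, hfpow, conj_eq_one_iff] at hfg
    exact hg.pow_ne_one (Nat.succ_pos m) hfg
  · exact hne h (m + 1) n (Nat.succ_pos m) hn0 hfg

end IsLoxodromicAt

end Loxodromic

/-! ### The quasimorphism of a family of shortcuts -/

/-- A real sequence which is additive up to the error `C` is linear up to the same error. -/
theorem exists_forall_abs_sub_mul_le {f : ℕ → ℝ} {C : ℝ}
    (hf : ∀ m n, |f m + f n - f (m + n)| ≤ C) : ∃ r : ℝ, ∀ n, |f n - n * r| ≤ C := by
  have key : ∀ {f : ℕ → ℝ}, (∀ m n, |f m + f n - f (m + n)| ≤ C) →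
      ∃ r : ℝ, Tendsto (fun n => f n / n) atTop (𝓝 r) ∧ ∀ n, n * r ≤ f n + C := by
    intro f hf
    have hsub : Subadditive fun n => f n + C := fun m n => by
      linarith [(abs_le.1 (hf m n)).1]
    have hlow : ∀ n : ℕ, n * (f 1 - C) ≤ f n + C := fun n => by
      induction n with
      | zero =>
        have := (abs_le.1 (hf 0 0)).1
        simp at this ⊢
        linarith
      | succ n ih =>
        push_cast
        linarith [(abs_le.1 (hf n 1)).2]
    have hbdd : BddBelow (Set.range fun n : ℕ => (f n + C) / n) := by
      refine ⟨min 0 (f 1 - C), ?_⟩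
      rintro _ ⟨n, rfl⟩
      rcases n.eq_zero_or_pos with rfl | hn
      · simp
      · refine (min_le_right _ _).trans ?_
        rw [le_div_iff₀ (by exact_mod_cast hn)]
        linarith [hlow n]
    refine ⟨hsub.lim, ?_, fun n => ?_⟩
    · have h := (hsub.tendsto_lim hbdd).sub (tendsto_const_div_atTop_nhds_zero_nat C)
      rw [sub_zero] at h
      exact h.congr fun n => by ring
    · rcases n.eq_zero_or_pos with rfl | hn
      · simpa using hlow 0
      · have h := hsub.lim_le_div hbdd hn.ne'
        rw [le_div_iff₀ (by exact_mod_cast hn)] at h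
        linarith
  obtain ⟨r, hr, hr'⟩ := key hf
  obtain ⟨r', hs, hs'⟩ := key (f := fun n => -f n) fun m n => by
    rw [← abs_neg]
    convert hf m n using 2
    ring
  obtain rfl : r' = -r := tendsto_nhds_unique hs (hr.neg.congr fun n => by ring)
  exact ⟨r, fun n => abs_le.2 ⟨by linarith [hr' n], by linarith [hs' n]⟩⟩

theorem tendsto_div_of_abs_sub_mul_le {f : ℕ → ℝ} {r C : ℝ} (h : ∀ n : ℕ, |f n - n * r| ≤ C) :
    Tendsto (fun n => f n / n) atTop (𝓝 r) := by
  rw [tendsto_iff_dist_tendsto_zero]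
  refine squeeze_zero' (Eventually.of_forall fun n => dist_nonneg) ?_
    (tendsto_const_div_atTop_nhds_zero_nat C)
  filter_upwards [eventually_gt_atTop 0] with n hn
  have hn' : (0 : ℝ) < n := by exact_mod_cast hn
  rw [Real.dist_eq, le_div_iff₀ hn']
  calc |f n / n - r| * n = |(f n / n - r) * n| := by rw [abs_mul, abs_of_pos hn']
    _ = |f n - n * r| := by congr 1; field_simp
    _ ≤ C := h n

/-- A quasimorphism is linear on the powers of an element, up to a bounded error. -/
theorem IsQuasimorphism.exists_forall_abs_sub_mul_le {G : Type*} [Group G] {φ : G → ℝ}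
    (hφ : IsQuasimorphism φ) (g : G) : ∃ r C : ℝ, ∀ n : ℕ, |φ (g ^ n) - n * r| ≤ C := by
  obtain ⟨C, hC⟩ := hφ
  obtain ⟨r, hr⟩ := _root_.exists_forall_abs_sub_mul_le (f := fun n => φ (g ^ n)) (C := C)
    fun m n => by rw [pow_add]; exact hC _ _
  exact ⟨r, C, hr⟩

theorem isQuasimorphism_sum {G J : Type*} [Group G] [Fintype J] {φ : J → G → ℝ}
    (hφ : ∀ j, IsQuasimorphism (φ j)) (c : J → ℝ) :
    IsQuasimorphism fun g => ∑ j, c j * φ j g := by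
  choose C hC using hφ
  refine ⟨∑ j, |c j| * C j, fun g h => ?_⟩
  rw [← Finset.sum_add_distrib, ← Finset.sum_sub_distrib]
  refine (Finset.abs_sum_le_sum_abs _ _).trans (Finset.sum_le_sum fun j _ => ?_)
  rw [← mul_add, ← mul_sub, abs_mul]
  exact mul_le_mul_of_nonneg_left (hC j g h) (abs_nonneg _)

section OrbitShortcuts

variable {G X : Type*} [Group G] [MetricSpace X] [MulAction G X] [IsIsometricSMul G X]

theorem chainCost_smul (p w : X) (c : ℝ) (k : G) (z : X) (l : List G) : ∀ x,
    chainCost (fun h : G => h • p) (fun h => h • w) c (k • x) (l.map (k * ·)) (k • z) =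
      chainCost (fun h : G => h • p) (fun h => h • w) c x l z := by
  induction l with
  | nil => exact fun x => dist_smul k x z
  | cons i l ih =>
    intro x
    simp only [List.map_cons, chainCost, mul_smul, dist_smul, ih]

theorem shortcutDist_smul {p w : X} {c W : ℝ}
    (h : IsShortcutFamily (fun h : G => h • p) (fun h => h • w) c W) (k : G) (x z : X) :
    shortcutDist (fun h : G => h • p) (fun h => h • w) c (k • x) (k • z) =
      shortcutDist (fun h : G => h • p) (fun h => h • w) c x z := by
  have key : ∀ (k : G) (x z : X),
      shortcutDist (fun h : G => h • p) (fun h => h • w) c (k • x) (k • z) ≤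
        shortcutDist (fun h : G => h • p) (fun h => h • w) c x z := fun k x z =>
    le_ciInf fun l => (h.shortcutDist_le_chainCost _ _ (l.map (k * ·))).trans
      (chainCost_smul p w c k z l x).le
  refine le_antisymm (key k x z) ?_
  simpa only [inv_smul_smul] using key k⁻¹ (k • x) (k • z)

theorem isQuasimorphism_shortcutDist_sub [GeodesicMetricSpace X] {δ : ℝ}
    (hδ : IsHyperbolicityConstant X δ) {p w : X} {c W : ℝ}
    (h : IsShortcutFamily (fun h : G => h • p) (fun h => h • w) c W) :
    IsQuasimorphism fun g : G =>
      shortcutDist (fun h : G => h • p) (fun h => h • w) c p (g • p) -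
        shortcutDist (fun h : G => h • p) (fun h => h • w) c (g • p) p := by
  obtain ⟨C, -, hC⟩ := exists_shortcutDist_add_le G hδ h.nonneg
  refine ⟨3 * (C + 2 * δ), fun g k => ?_⟩
  have h₁ := h.abs_sub_add_sub_le hδ (hC _ _ _ h) p (g • p) (g • k • p)
  rw [shortcutDist_smul h, shortcutDist_smul h] at h₁
  simpa only [mul_smul] using h₁

namespace IsLoxodromicAt

variable {g : G} {p : X} {σ C : ℝ} (hg : IsLoxodromicAt g p σ C)
include hg

omit [IsIsometricSMul G X] in
theorem eventually_le_dist (r : ℝ) : ∀ᶠ N : ℕ in atTop, r ≤ dist p (g ^ N • p) :=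
  hg.tendsto_dist.eventually_ge_atTop r

theorem isShortcutFamily {W : ℝ} (hW : 0 ≤ W) : ∀ᶠ N : ℕ in atTop,
    IsShortcutFamily (fun h : G => h • p) (fun h => h • g ^ N • p) (dist p (g ^ N • p) - W) W := by
  filter_upwards [hg.eventually_le_dist (2 * W + 1)] with N hN
  exact ⟨by linarith, hW, by linarith, fun h => by rw [dist_smul]; linarith⟩

/-- Long shortcuts along the axis of `g` and its translates are useless for travelling along the
axis of `g'`, unless some conjugate of `g` has a positive power in common with `g'`. -/
theorem eventually_shortcutDist_eq [GeodesicMetricSpace X] {δ : ℝ}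
    (hδ : IsHyperbolicityConstant X δ) (hG : IsWeaklyAcylindrical G X) {g' : G} {σ' C' : ℝ}
    (hg' : IsLoxodromicAt g' p σ' C')
    (hne : ∀ (h : G) (m n : ℕ), 0 < m → 0 < n → (h * g * h⁻¹) ^ m ≠ g' ^ n) {W : ℝ}
    (hW : 0 ≤ W) : ∀ᶠ N : ℕ in atTop, ∀ n : ℕ,
      shortcutDist (fun h : G => h • p) (fun h => h • g ^ N • p) (dist p (g ^ N • p) - W)
        p (g' ^ n • p) = dist p (g' ^ n • p) := by
  obtain ⟨K, hK, hadd⟩ := exists_shortcutDist_add_le G hδ hW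
  have hpos := hδ.pos
  have hσ' := hg'.pos
  have hC' := hg'.nonneg
  set K' : ℝ := 2 * K + 1 + 5 * δ with hK'
  set B : ℝ := σ' + 5 * C' + 4 * K' + 2 * δ with hB
  filter_upwards [hg.isShortcutFamily hW, hg.eventually_not_fellowTravel hδ hG hg' hne B,
    hg.eventually_le_dist (W + 2 + K + 4 * C' + 2 * B)] with N hfam hfellow hlong n
  set c : ℝ := dist p (g ^ N • p) - W with hc
  set D := shortcutDist (fun h : G => h • p) (fun h => h • g ^ N • p) c with hD
  set z := g' ^ n • p with hz
  refine le_antisymm (hfam.shortcutDist_le_dist _ _) (not_lt.1 fun hlt => ?_)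
  obtain ⟨l, hl⟩ := IsShortcutFamily.exists_chainCost_lt (lt_min hlt (lt_add_one (D p z)))
  obtain ⟨hl₁, hl₂⟩ := lt_min_iff.1 hl
  match l with
  | [] => exact lt_irrefl _ hl₁
  | h :: l =>
    simp only [chainCost] at hl₂
    set u := h • p with hu
    set v := h • g ^ N • p with hv
    have hvz := hfam.shortcutDist_le_chainCost v z l
    have hpu := hfam.shortcutDist_le_dist p u
    have huv : D u v ≤ c := hfam.shortcutDist_source_target_le h
    have htotal : D p u + c + D v z ≤ D p z + 1 := by linarith
    have hu' : gromovProd u p z ≤ K' := hfam.gromovProd_le hδ (hadd _ _ _ hfam) (by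
      linarith [hfam.shortcutDist_triangle u v z])
    have hv' : gromovProd v p z ≤ K' := hfam.gromovProd_le hδ (hadd _ _ _ hfam) (by
      linarith [hfam.shortcutDist_triangle p u v])
    obtain ⟨i, hi, hui⟩ := hg'.exists_dist_pow_smul_le hδ (by positivity) hu'
    obtain ⟨j, hj, hvj⟩ := hg'.exists_dist_pow_smul_le hδ (by positivity) hv'
    rcases le_or_gt i j with hij | hij
    · -- The shortcut runs forward along the axis of `g'`.
      refine hfellow ((g' ^ i)⁻¹ * h) (j - i) ?_ ?_
      · rw [← dist_smul (g' ^ i), mul_smul, smul_inv_smul]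
        exact hui
      · rw [← dist_smul (g' ^ i), mul_smul, smul_inv_smul, smul_smul (g' ^ i), ← pow_add,
          Nat.add_sub_cancel' hij]
        exact hvj
    · -- A shortcut which runs backward does not pay.
      have h₁ := hadd _ _ _ hfam p (g' ^ j • p) (g' ^ i • p)
      have h₂ := hg'.gromovProd_pow_smul_le hij.le
      have h₃ := hfam.shortcutDist_le_right p u (g' ^ i • p)
      have h₄ := hfam.shortcutDist_le_left (g' ^ j • p) v z
      have h₅ := hfam.shortcutDist_triangle p (g' ^ j • p) z
      have h₆ : 0 ≤ D (g' ^ j • p) (g' ^ i • p) := by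
        have := hfam.dist_le_two_mul_shortcutDist (g' ^ j • p) (g' ^ i • p)
        linarith [dist_nonneg (x := g' ^ j • p) (y := g' ^ i • p)]
      rw [dist_comm] at h₄
      linarith

/-- A quasimorphism which detects `g`, and which vanishes on the powers of the elements `g' j`.
It measures how much more the shortcuts along the axis of `g` save in one direction than in the
opposite direction. -/
theorem exists_isQuasimorphism [GeodesicMetricSpace X] {δ : ℝ}
    (hδ : IsHyperbolicityConstant X δ) (hG : IsWeaklyAcylindrical G X)
    (hinv : ∀ (h : G) (m n : ℕ), 0 < m → 0 < n → (h * g * h⁻¹) ^ m ≠ g⁻¹ ^ n)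
    {J : Type*} [Finite J] {g' : J → G} {σ' C' : J → ℝ}
    (hg' : ∀ j, IsLoxodromicAt (g' j) p (σ' j) (C' j))
    (hne : ∀ (j : J) (h : G) (m n : ℕ), 0 < m → 0 < n → (h * g * h⁻¹) ^ m ≠ g' j ^ n)
    (hne' : ∀ (j : J) (h : G) (m n : ℕ), 0 < m → 0 < n → (h * g * h⁻¹) ^ m ≠ (g' j)⁻¹ ^ n) :
    ∃ φ : G → ℝ, IsQuasimorphism φ ∧
      (∃ r C : ℝ, r ≠ 0 ∧ ∀ n : ℕ, |φ (g ^ n) - n * r| ≤ C) ∧ ∀ j (n : ℕ), φ (g' j ^ n) = 0 := by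
  have hC := hg.nonneg
  -- A shortcut has to save more than the deviation `C` of its length from a multiple of `σ`.
  set W : ℝ := C + 1 with hW
  have hW0 : 0 ≤ W := by positivity
  obtain ⟨N, hfam, hback, hforw', hback'⟩ := ((hg.isShortcutFamily hW0).and
    ((hg.eventually_shortcutDist_eq hδ hG hg.inv hinv hW0).and
    ((eventually_all.2 fun j => hg.eventually_shortcutDist_eq hδ hG (hg' j) (hne j) hW0).and
    (eventually_all.2 fun j =>
      hg.eventually_shortcutDist_eq hδ hG (hg' j).inv (hne' j) hW0)))).exists
  set D := shortcutDist (fun h : G => h • p) (fun h => h • g ^ N • p)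
    (dist p (g ^ N • p) - W) with hD
  have hswap : ∀ (k : G) (n : ℕ), D (k ^ n • p) p = D p (k⁻¹ ^ n • p) := fun k n => by
    have := shortcutDist_smul hfam (k⁻¹ ^ n) (k ^ n • p) p
    rw [inv_pow, inv_smul_smul] at this
    rw [hD, inv_pow]
    exact this.symm
  have hφ := isQuasimorphism_shortcutDist_sub hδ hfam
  refine ⟨_, hφ, ?_, fun j n => ?_⟩
  · obtain ⟨r, E, hr⟩ := hφ.exists_forall_abs_sub_mul_le g
    refine ⟨r, E, ?_, hr⟩
    rintro rfl
    have hforw : ∀ n : ℕ, D p (g ^ (N * n) • p) ≤ n * (dist p (g ^ N • p) - W) := fun n => by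
      induction n with
      | zero => simpa using hfam.shortcutDist_le_dist p p
      | succ n ih =>
        have h₁ := hfam.shortcutDist_triangle p (g ^ (N * n) • p) (g ^ (N * n) • g ^ N • p)
        have h₂ := hfam.shortcutDist_source_target_le (g ^ (N * n))
        rw [mul_add, mul_one, pow_add, mul_smul]
        push_cast
        linarith
    obtain ⟨n, hn⟩ := exists_nat_gt (E + C)
    have h₁ := (abs_le.1 (hr (N * n))).1
    have h₂ : D (g ^ (N * n) • p) p = dist p (g ^ (N * n) • p) := by
      rw [hswap, hback, dist_inv_pow_smul]
    have h₃ := hforw n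
    have h₄ := hg.le_dist (N * n)
    have h₅ := mul_le_mul_of_nonneg_left (hg.dist_le N) (Nat.cast_nonneg (α := ℝ) n)
    push_cast at h₄
    have h₆ : -E ≤ D p (g ^ (N * n) • p) - D (g ^ (N * n) • p) p := by simpa using h₁
    rw [h₂] at h₆
    linarith
  · change D p (g' j ^ n • p) - D (g' j ^ n • p) p = 0
    rw [hswap, hforw', hback', dist_inv_pow_smul, sub_self]

end IsLoxodromicAt

end OrbitShortcuts

/-! ### Fixed points on the boundary -/

section BoundaryPoints

variable {X : Type*} [MetricSpace X]

namespace GromovSeq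

theorem equivalent_of_dist_le {y z : GromovSeq X} {B : ℝ} (h : ∀ n, dist (y.1 n) (z.1 n) ≤ B) :
    y.Equivalent z := fun p => by
  refine tendsto_atTop_mono (fun n => ?_)
    (tendsto_atTop_add_const_right _ (-B) ((y.2 p).comp tendsto_atTop_diagonal))
  have := gromovProd_le_add_dist_right p (y.1 n) (y.1 n) (z.1 n)
  simp only [Function.comp_apply]
  linarith [h n]

theorem exists_forall_le_gromovProd (y : GromovSeq X) (p : X) (r : ℝ) :
    ∃ M, ∀ i ≥ M, ∀ j ≥ M, r ≤ gromovProd p (y.1 i) (y.1 j) := by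
  obtain ⟨⟨M, M'⟩, h⟩ := eventually_atTop.1 ((y.2 p).eventually_ge_atTop r)
  exact ⟨max M M', fun i hi j hj =>
    h (i, j) ⟨(le_max_left _ _).trans hi, (le_max_right _ _).trans hj⟩⟩

/-- A subsequence of a sequence converging to infinity. -/
def subseq (y : GromovSeq X) {φ : ℕ → ℕ} (hφ : Tendsto φ atTop atTop) : GromovSeq X :=
  ⟨fun n => y.1 (φ n), fun p => tendsto_atTop.2 fun r => by
    obtain ⟨M, hM⟩ := y.exists_forall_le_gromovProd p r
    obtain ⟨N, hN⟩ := eventually_atTop.1 (hφ.eventually_ge_atTop M)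
    filter_upwards [eventually_ge_atTop ((N, N) : ℕ × ℕ)] with n hn
    exact hM _ (hN _ hn.1) _ (hN _ hn.2)⟩

theorem equivalent_subseq (y : GromovSeq X) {φ : ℕ → ℕ} (hφ : Tendsto φ atTop atTop) :
    y.Equivalent (y.subseq hφ) := fun p => tendsto_atTop.2 fun r => by
  obtain ⟨M, hM⟩ := y.exists_forall_le_gromovProd p r
  filter_upwards [eventually_ge_atTop M, hφ.eventually_ge_atTop M] with n hn hn'
  exact hM _ hn _ hn'

theorem exists_eventually_gromovProd_le {δ : ℝ} (hδ : IsHyperbolicityConstant X δ)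
    {y z : GromovSeq X} (h : ¬ y.Equivalent z) (p : X) :
    ∃ K : ℝ, 0 ≤ K ∧ ∀ᶠ i in atTop, gromovProd p (y.1 i) (z.1 i) ≤ K := by
  simp only [Equivalent, tendsto_atTop, not_forall, not_eventually, not_le] at h
  obtain ⟨q, r, hr⟩ := h
  have hpos := hδ.pos
  obtain ⟨M, hM⟩ := y.exists_forall_le_gromovProd q (r + 2 * δ)
  obtain ⟨M', hM'⟩ := z.exists_forall_le_gromovProd q (r + 2 * δ)
  refine ⟨max 0 (r + 2 * δ + dist p q), le_max_left _ _, ?_⟩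
  filter_upwards [eventually_ge_atTop M, eventually_ge_atTop M'] with i hi hi'
  refine le_max_of_le_right ((gromovProd_le_add_dist p q _ _).trans ?_)
  gcongr
  by_contra! hlt
  obtain ⟨n, hn, hnr⟩ := frequently_atTop.1 hr (max M M')
  have h₁ := hδ.le_gromovProd (hM n ((le_max_left _ _).trans hn) i hi) hlt.le
  have h₂ := hM' i hi' n ((le_max_right _ _).trans hn)
  linarith [hδ.le_gromovProd h₁ (by linarith)]

theorem Equivalent.eventually_gromovProd_le {δ : ℝ} (hδ : IsHyperbolicityConstant X δ)
    {y y' z z' : GromovSeq X} (hy : y'.Equivalent y) (hz : z'.Equivalent z) {p : X} {K : ℝ}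
    (h : ∀ᶠ i in atTop, gromovProd p (y.1 i) (z.1 i) ≤ K) :
    ∀ᶠ i in atTop, gromovProd p (y'.1 i) (z'.1 i) ≤ K + 2 * δ := by
  filter_upwards [h, (hy p).eventually_ge_atTop (K + 2 * δ + 1),
    (hz p).eventually_ge_atTop (K + 2 * δ + 1)] with i h₁ h₂ h₃
  by_contra! hlt
  rw [gromovProd_comm] at h₂
  have hpos := hδ.pos
  have h₄ := hδ.four_point p (y.1 i) (y'.1 i) (z'.1 i)
  have h₅ := hδ.four_point p (y.1 i) (z'.1 i) (z.1 i)
  rcases min_choice (gromovProd p (y.1 i) (y'.1 i)) (gromovProd p (y'.1 i) (z'.1 i))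
    with h₆ | h₆ <;>
  rcases min_choice (gromovProd p (y.1 i) (z'.1 i)) (gromovProd p (z'.1 i) (z.1 i))
    with h₇ | h₇ <;> rw [h₆] at h₄ <;> rw [h₇] at h₅ <;> linarith

end GromovSeq

variable {G : Type*} [Group G] [MulAction G X] [IsIsometricSMul G X]

theorem GromovSeq.equivalent_map_of_smul_mk [GromovHyperbolicSpace X] {k : G} {y : GromovSeq X}
    (h : k • GromovBoundary.mk y = GromovBoundary.mk y) : (y.map k).Equivalent y :=
  Quotient.exact (s := gromovSetoid X) h

theorem GromovSeq.equivalent_map_pow_inv [GromovHyperbolicSpace X] {g : G} {y : GromovSeq X}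
    (h : g • GromovBoundary.mk y = GromovBoundary.mk y) (n : ℕ) :
    (y.map (g ^ n)⁻¹).Equivalent y :=
  GromovSeq.equivalent_map_of_smul_mk (MulAction.mem_stabilizer_iff.1
    (inv_mem (pow_mem (MulAction.mem_stabilizer_iff.2 h) n)))

/-- The coarse line between two boundary points is preserved by the isometries which fix them, and
hence passes close to all translates of `p`, with a constant which does not depend on the
isometry. -/
theorem eventually_gromovProd_smul_le {δ : ℝ} (hδ : IsHyperbolicityConstant X δ)
    {y z : GromovSeq X} {p : X} {K : ℝ}
    (hK : ∀ᶠ i in atTop, gromovProd p (y.1 i) (z.1 i) ≤ K) {k : G}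
    (hy : (y.map k⁻¹).Equivalent y) (hz : (z.map k⁻¹).Equivalent z) :
    ∀ᶠ i in atTop, gromovProd (k • p) (y.1 i) (z.1 i) ≤ K + 2 * δ := by
  filter_upwards [GromovSeq.Equivalent.eventually_gromovProd_le hδ hy hz hK] with i hi
  rw [← inv_inv k, ← gromovProd_smul]
  exact hi

/-- Seen from `p`, the point `k • p` is in the direction of one of the two fixed points of `k`. -/
theorem eventually_le_gromovProd_or {δ : ℝ} (hδ : IsHyperbolicityConstant X δ)
    {y z : GromovSeq X} {p : X} {K : ℝ}
    (hK : ∀ᶠ i in atTop, gromovProd p (y.1 i) (z.1 i) ≤ K) {k : G}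
    (hy : (y.map k⁻¹).Equivalent y) (hz : (z.map k⁻¹).Equivalent z) :
    ∀ᶠ i in atTop,
      (dist p (k • p) - (2 * K + 3 * δ) ≤ gromovProd p (k • p) (y.1 i) ∧
        gromovProd p (k • p) (z.1 i) ≤ K + δ) ∨
      (dist p (k • p) - (2 * K + 3 * δ) ≤ gromovProd p (k • p) (z.1 i) ∧
        gromovProd p (k • p) (y.1 i) ≤ K + δ) := by
  filter_upwards [hK, eventually_gromovProd_smul_le hδ hK hy hz] with i h₁ h₂
  have h₃ := hδ.four_point p (y.1 i) (k • p) (z.1 i)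
  have h₄ : dist p (k • p) - (K + 2 * δ) ≤
      gromovProd p (k • p) (y.1 i) + gromovProd p (k • p) (z.1 i) := by
    unfold gromovProd at h₂ ⊢
    linarith [dist_triangle_right (y.1 i) (z.1 i) p, dist_comm (k • p) (y.1 i),
      dist_comm (k • p) (z.1 i), dist_comm p (k • p)]
  rw [gromovProd_comm p (y.1 i)] at h₃
  rcases min_choice (gromovProd p (k • p) (y.1 i)) (gromovProd p (k • p) (z.1 i)) with h | h <;>
    rw [h] at h₃
  · exact Or.inr ⟨by linarith, by linarith⟩
  · exact Or.inl ⟨by linarith, by linarith⟩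

/-- The Busemann function of the boundary point given by `y`, normalized at `p`, at the point
`k • p`. The limit which defines it is taken along an ultrafilter, as it need not exist
otherwise. -/
noncomputable def busemann (y : GromovSeq X) (p : X) (k : G) : ℝ :=
  limUnder (hyperfilter ℕ : Filter ℕ) fun i => dist (k • p) (y.1 i) - dist p (y.1 i)

omit [IsIsometricSMul G X] in
theorem tendsto_busemann (y : GromovSeq X) (p : X) (k : G) :
    Tendsto (fun i => dist (k • p) (y.1 i) - dist p (y.1 i)) (hyperfilter ℕ : Filter ℕ)
      (𝓝 (busemann y p k)) := by
  refine tendsto_nhds_limUnder ?_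
  have hmem : ∀ i, dist (k • p) (y.1 i) - dist p (y.1 i) ∈
      Set.Icc (-dist p (k • p)) (dist p (k • p)) := fun i =>
    ⟨by linarith [dist_triangle p (k • p) (y.1 i)],
      by linarith [dist_triangle_left (k • p) (y.1 i) p]⟩
  obtain ⟨x, -, hx⟩ := isCompact_Icc.ultrafilter_le_nhds
    ((hyperfilter ℕ).map fun i => dist (k • p) (y.1 i) - dist p (y.1 i))
    (le_principal_iff.2 (mem_map.2 (Eventually.of_forall hmem)))
  exact ⟨x, hx⟩

theorem eventually_hyperfilter {P : ℕ → Prop} (h : ∀ᶠ i in atTop, P i) :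
    ∀ᶠ i in (hyperfilter ℕ : Filter ℕ), P i :=
  (Nat.cofinite_eq_atTop ▸ hyperfilter_le_cofinite (α := ℕ)) h

theorem abs_busemann_mul_le {δ : ℝ} (hδ : IsHyperbolicityConstant X δ) {y : GromovSeq X} (p : X)
    {k : G} (hy : (y.map k⁻¹).Equivalent y) (k' : G) :
    |busemann y p k + busemann y p k' - busemann y p (k * k')| ≤ 2 * δ := by
  refine le_of_tendsto (((tendsto_busemann y p k).add (tendsto_busemann y p k')).sub
    (tendsto_busemann y p (k * k'))).abs (eventually_hyperfilter ?_)
  filter_upwards [(hy p).eventually_ge_atTop (dist p (k' • p))] with i hi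
  have h₁ : dist ((k * k') • p) (y.1 i) = dist (k' • p) (k⁻¹ • y.1 i) := by
    rw [← dist_smul k (k' • p), smul_inv_smul, mul_smul]
  have h₂ : dist (k • p) (y.1 i) = dist p (k⁻¹ • y.1 i) := by
    rw [← dist_smul k p, smul_inv_smul]
  have h₃ : gromovProd p (k' • p) (k⁻¹ • y.1 i) - δ ≤ gromovProd p (k' • p) (y.1 i) :=
    hδ.le_gromovProd le_rfl ((gromovProd_le_dist_left p _ _).trans hi)
  have h₄ : gromovProd p (k' • p) (y.1 i) - δ ≤ gromovProd p (k' • p) (k⁻¹ • y.1 i) := by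
    rw [gromovProd_comm] at hi
    exact hδ.le_gromovProd le_rfl ((gromovProd_le_dist_left p _ _).trans hi)
  rw [h₁, h₂, abs_le]
  unfold gromovProd at h₃ h₄
  rw [dist_comm (k⁻¹ • y.1 i) p, dist_comm (y.1 i) p] at h₃ h₄
  constructor <;> linarith

theorem abs_abs_busemann_sub_dist_le {δ : ℝ} (hδ : IsHyperbolicityConstant X δ)
    {y z : GromovSeq X} {p : X} {K : ℝ} (hK₀ : 0 ≤ K)
    (hK : ∀ᶠ i in atTop, gromovProd p (y.1 i) (z.1 i) ≤ K) {k : G}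
    (hy : (y.map k⁻¹).Equivalent y) (hz : (z.map k⁻¹).Equivalent z) :
    |(|busemann y p k| - dist p (k • p))| ≤ 4 * K + 6 * δ := by
  refine le_of_tendsto ((tendsto_busemann y p k).abs.sub_const _).abs (eventually_hyperfilter ?_)
  have hpos := hδ.pos
  filter_upwards [eventually_le_gromovProd_or hδ hK hy hz] with i hi
  have h₁ : |dist (k • p) (y.1 i) - dist p (y.1 i)| ≤ dist p (k • p) := by
    rw [dist_comm p (k • p)]
    exact abs_dist_sub_le _ _ _
  rw [abs_le]
  refine ⟨?_, by linarith⟩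
  unfold gromovProd at hi
  rw [dist_comm (k • p) p, dist_comm (y.1 i) p] at hi
  rcases hi with ⟨h, -⟩ | ⟨-, h⟩
  · linarith [neg_abs_le (dist (k • p) (y.1 i) - dist p (y.1 i))]
  · linarith [le_abs_self (dist (k • p) (y.1 i) - dist p (y.1 i))]

/-- An isometry with unbounded orbits which fixes two boundary points is loxodromic, because the
Busemann function of a fixed point is a quasimorphism on its powers. -/
theorem exists_isLoxodromicAt [GromovHyperbolicSpace X] {g : G} {a b : GromovBoundary X}
    (hab : a ≠ b) (ha : g • a = a) (hb : g • b = b) (p : X)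
    (hunb : ¬ Bornology.IsBounded (Set.range fun n : ℤ => g ^ n • p)) :
    ∃ σ C, IsLoxodromicAt g p σ C := by
  obtain ⟨δ, hδ⟩ := exists_isHyperbolicityConstant X
  induction a using Quotient.inductionOn with | _ y
  induction b using Quotient.inductionOn with | _ z
  obtain ⟨K, hK₀, hK⟩ := GromovSeq.exists_eventually_gromovProd_le hδ
    (fun h => hab (Quotient.sound (s := gromovSetoid X) h)) p
  have hpos := hδ.pos
  obtain ⟨r, hr⟩ := exists_forall_abs_sub_mul_le (f := fun n => busemann y p (g ^ n))
    (C := 2 * δ) fun m n => by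
      rw [pow_add]
      exact abs_busemann_mul_le hδ p (GromovSeq.equivalent_map_pow_inv ha m) _
  have hdist : ∀ n : ℕ, |dist p (g ^ n • p) - n * (|r|)| ≤ 4 * K + 8 * δ := fun n => by
    have h₁ := abs_le.1 (abs_abs_busemann_sub_dist_le hδ hK₀ hK
      (GromovSeq.equivalent_map_pow_inv ha n) (GromovSeq.equivalent_map_pow_inv hb n))
    have h₂ := abs_le.1 ((abs_abs_sub_abs_le_abs_sub (busemann y p (g ^ n)) (n * r)).trans (hr n))
    rw [abs_mul, Nat.abs_cast] at h₂
    rw [abs_le]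
    constructor <;> linarith
  have hr0 : r ≠ 0 := by
    rintro rfl
    refine hunb ((Metric.isBounded_closedBall (x := p) (r := 4 * K + 8 * δ)).subset ?_)
    rintro _ ⟨n, rfl⟩
    have h₁ : ∀ n : ℕ, dist p (g ^ n • p) ≤ 4 * K + 8 * δ := fun n => by
      simpa using hdist n
    rw [Metric.mem_closedBall, dist_comm]
    rcases Int.eq_nat_or_neg n with ⟨m, rfl | rfl⟩
    · simpa using h₁ m
    · simpa [dist_inv_pow_smul, ← inv_pow] using h₁ m
  exact ⟨|r|, 4 * K + 8 * δ, abs_pos.2 hr0, by positivity, hdist⟩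

namespace IsLoxodromicAt

variable {g : G} {p : X} {σ C : ℝ} (hg : IsLoxodromicAt g p σ C)
include hg

theorem le_gromovProd_pow_smul {i j : ℕ} (h : i ≤ j) :
    i * σ - 3 * C ≤ gromovProd p (g ^ i • p) (g ^ j • p) := by
  have h₁ := gromovProd_add_gromovProd p (g ^ i • p) (g ^ j • p)
  linarith [hg.gromovProd_pow_smul_le h, hg.le_dist i]

/-- The forward orbit of `p` converges to infinity. -/
def orbitSeq : GromovSeq X :=
  ⟨fun n => g ^ n • p, fun q => by
    have hσ := hg.pos
    refine tendsto_atTop.2 fun r => ?_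
    obtain ⟨N, hN⟩ := exists_nat_gt ((r + 3 * C + dist p q) / σ)
    rw [div_lt_iff₀ hσ] at hN
    filter_upwards [eventually_ge_atTop ((N, N) : ℕ × ℕ)] with ⟨i, j⟩ ⟨hi, hj⟩
    have h₁ : (N : ℝ) * σ ≤ i * σ := by gcongr
    have h₂ : (N : ℝ) * σ ≤ j * σ := by gcongr
    have h₃ := gromovProd_le_add_dist p q (g ^ i • p) (g ^ j • p)
    rcases le_total i j with h | h
    · linarith [hg.le_gromovProd_pow_smul h]
    · linarith [hg.le_gromovProd_pow_smul h, gromovProd_comm p (g ^ i • p) (g ^ j • p)]⟩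

variable [GromovHyperbolicSpace X]

/-- The attracting fixed point on the boundary. -/
def attracting : GromovBoundary X :=
  GromovBoundary.mk hg.orbitSeq

theorem attracting_ne_attracting_inv : hg.attracting ≠ hg.inv.attracting := by
  intro h
  have h₁ : hg.orbitSeq.Equivalent hg.inv.orbitSeq := Quotient.exact (s := gromovSetoid X) h
  obtain ⟨n, hn⟩ := ((h₁ p).eventually_gt_atTop (2 * C)).exists
  refine hn.not_ge ?_
  have h₂ := hg.gromovProd_pow_smul_le (Nat.le_add_left n n)
  rw [← gromovProd_smul_smul_smul (g ^ n)⁻¹, inv_smul_smul, pow_add, mul_smul, inv_smul_smul,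
    gromovProd_comm, ← inv_pow] at h₂
  exact h₂

theorem attracting_eq_of_frequently {y : GromovSeq X} {B : ℝ}
    (h : ∃ᶠ n in atTop, ∃ᶠ i in atTop,
      dist p (g ^ n • p) - B ≤ gromovProd p (g ^ n • p) (y.1 i)) :
    hg.attracting = GromovBoundary.mk y := by
  obtain ⟨δ, hδ⟩ := exists_isHyperbolicityConstant X
  obtain ⟨φ, hφ, hφ'⟩ := extraction_of_frequently_atTop h
  refine Quotient.sound (s := gromovSetoid X)
    ((hg.orbitSeq.equivalent_subseq hφ.tendsto_atTop).trans fun q => ?_)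
  refine tendsto_atTop.2 fun r => ?_
  set r' := r + δ + dist p q with hr'
  obtain ⟨M, hM⟩ := y.exists_forall_le_gromovProd p r'
  filter_upwards [eventually_ge_atTop M,
    (hg.tendsto_dist.comp hφ.tendsto_atTop).eventually_ge_atTop (r' + B)] with n hn hn'
  obtain ⟨i, hi, hi'⟩ := frequently_atTop.1 (hφ' n) M
  simp only [Function.comp_apply] at hn'
  have h₁ : r' - δ ≤ gromovProd p (g ^ φ n • p) (y.1 n) :=
    hδ.le_gromovProd (by linarith) (hM i hi n hn)
  change r ≤ gromovProd q (g ^ φ n • p) (y.1 n)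
  linarith [gromovProd_le_add_dist p q (g ^ φ n • p) (y.1 n)]

/-- The attracting point is one of any two distinct fixed points: the orbit of `p` stays close to
the coarse line between them, and infinitely many of its points lie on the same side. -/
theorem attracting_eq_or_eq {a b : GromovBoundary X} (hab : a ≠ b) (ha : g • a = a)
    (hb : g • b = b) : hg.attracting = a ∨ hg.attracting = b := by
  obtain ⟨δ, hδ⟩ := exists_isHyperbolicityConstant X
  induction a using Quotient.inductionOn with | _ y
  induction b using Quotient.inductionOn with | _ z
  obtain ⟨K, hK₀, hK⟩ := GromovSeq.exists_eventually_gromovProd_le hδ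
    (fun h => hab (Quotient.sound (s := gromovSetoid X) h)) p
  have hor : ∃ᶠ n in atTop,
      (∃ᶠ i in atTop,
        dist p (g ^ n • p) - (2 * K + 3 * δ) ≤ gromovProd p (g ^ n • p) (y.1 i)) ∨
      ∃ᶠ i in atTop,
        dist p (g ^ n • p) - (2 * K + 3 * δ) ≤ gromovProd p (g ^ n • p) (z.1 i) :=
    Frequently.of_forall fun n => frequently_or_distrib.1
      ((eventually_le_gromovProd_or hδ hK (GromovSeq.equivalent_map_pow_inv ha n)
        (GromovSeq.equivalent_map_pow_inv hb n)).mono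
        fun i hi => hi.imp And.left And.left).frequently
  exact (frequently_or_distrib.1 hor).imp hg.attracting_eq_of_frequently
    hg.attracting_eq_of_frequently

theorem smul_attracting_eq {g' : G} {σ' C' : ℝ} (hg' : IsLoxodromicAt g' p σ' C') {h : G}
    {m n : ℕ} (hm : 0 < m) (hn : 0 < n) (hmn : (h * g * h⁻¹) ^ m = g' ^ n) :
    h • hg.attracting = hg'.attracting := by
  have hm' : Tendsto (fun k => m * k) atTop atTop := tendsto_id.const_mul_atTop' hm
  have hn' : Tendsto (fun k => n * k) atTop atTop := tendsto_id.const_mul_atTop' hn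
  refine Quotient.sound (s := gromovSetoid X) (a := hg.orbitSeq.map h)
    ((GromovSeq.Equivalent.map h (hg.orbitSeq.equivalent_subseq hm')).trans
      (GromovSeq.Equivalent.trans ?_ (hg'.orbitSeq.equivalent_subseq hn').symm))
  refine GromovSeq.equivalent_of_dist_le (B := dist (h • p) p) fun k => le_of_eq ?_
  change dist (h • g ^ (m * k) • p) (g' ^ (n * k) • p) = dist (h • p) p
  rw [pow_mul g', ← hmn, conj_pow, conj_pow, ← pow_mul, mul_smul, mul_smul, dist_smul, dist_smul,
    ← dist_smul h p, smul_inv_smul]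

end IsLoxodromicAt

end BoundaryPoints

/-! ### Prescribed values -/

theorem IsHyperbolicElement.exists_isLoxodromicAt {G X : Type*} [Group G] [MetricSpace X]
    [MulAction G X] [IsIsometricSMul G X] [GromovHyperbolicSpace X] {g : G}
    {a b : GromovBoundary X} (hg : IsHyperbolicElement g a b) (p : X) :
    ∃ (σ C : ℝ) (hl : IsLoxodromicAt g p σ C),
      (hl.attracting = a ∧ hl.inv.attracting = b) ∨
        (hl.attracting = b ∧ hl.inv.attracting = a) := by
  have hab := hg.northSouth.ne
  have ha := hg.northSouth.smul_attracting
  have hb := hg.northSouth.smul_repelling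
  obtain ⟨σ, C, hl⟩ := _root_.exists_isLoxodromicAt hab ha hb p (hg.unbounded p)
  have h := hl.attracting_ne_attracting_inv
  have h₁ := hl.attracting_eq_or_eq hab ha hb
  have h₂ := hl.inv.attracting_eq_or_eq hab (inv_smul_eq_iff.2 ha.symm) (inv_smul_eq_iff.2 hb.symm)
  refine ⟨σ, C, hl, ?_⟩
  rcases h₁ with h₁ | h₁ <;> rcases h₂ with h₂ | h₂
  · exact absurd (h₁.trans h₂.symm) h
  · exact Or.inl ⟨h₁, h₂⟩
  · exact Or.inr ⟨h₁, h₂⟩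
  · exact absurd (h₁.trans h₂.symm) h

theorem corollary4p4 {Γ X : Type*} [Group Γ] [Countable Γ]
    [MetricSpace X] [GeodesicMetricSpace X] [GromovHyperbolicSpace X]
    [MulAction Γ X] [IsIsometricSMul Γ X] (hΓ : IsWeaklyAcylindrical Γ X)
    (k : ℕ) (g : Fin k → Γ) (a b : Fin k → GromovBoundary X)
    (hg : ∀ i, IsHyperbolicElement (g i) (a i) (b i))
    (hdisj : Pairwise fun s t : Fin k ⊕ Fin k =>
      Disjoint
        (MulAction.orbit Γ (Sum.elim (fun i => (a i, b i)) (fun i => (b i, a i)) s))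
        (MulAction.orbit Γ (Sum.elim (fun i => (a i, b i)) (fun i => (b i, a i)) t)))
    (q : Fin k → ℝ) :
    ∃ φ : Γ → ℝ, IsQuasimorphism φ ∧
      ∀ i, Tendsto (fun l : ℕ => φ (g i ^ l) / (l : ℝ)) atTop (𝓝 (q i)) := by
  obtain ⟨δ, hδ⟩ := exists_isHyperbolicityConstant X
  rcases isEmpty_or_nonempty X with hX | ⟨⟨p⟩⟩
  · -- The boundary of the empty space is empty, so that there are no elements `g i`.
    exact ⟨fun _ => 0, ⟨0, by simp⟩, fun i => (hX.false ((a i).out.1 0)).elim⟩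
  set P : Fin k ⊕ Fin k → GromovBoundary X × GromovBoundary X :=
    Sum.elim (fun i => (a i, b i)) (fun i => (b i, a i)) with hP
  have horbit : ∀ {s t : Fin k ⊕ Fin k} (h : Γ), h • P s = P t → s = t := fun {s t} h hst => by
    by_contra hne
    exact Set.disjoint_left.1 (hdisj hne) ⟨h, hst⟩ (MulAction.mem_orbit_self (P t))
  choose σ C hl hends using fun i => (hg i).exists_isLoxodromicAt p
  -- The dynamics on the boundary do not tell the two fixed points of `g i` apart if there is no
  -- third boundary point; `e i` selects the order in which the first point attracts the orbits
  -- in `X`.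
  have he : ∀ i, ∃ s : Fin k ⊕ Fin k, Sum.elim id id s = i ∧
      P s = ((hl i).attracting, (hl i).inv.attracting) ∧
      P s.swap = ((hl i).inv.attracting, (hl i).attracting) := fun i => by
    rcases hends i with ⟨h₁, h₂⟩ | ⟨h₁, h₂⟩
    · exact ⟨Sum.inl i, rfl, by rw [h₁, h₂]; rfl, by rw [h₁, h₂]; rfl⟩
    · exact ⟨Sum.inr i, rfl, by rw [h₁, h₂]; rfl, by rw [h₁, h₂]; rfl⟩
  choose e he₁ he₂ he₃ using he
  have hconj_inv : ∀ {x y h : Γ} {m n : ℕ}, (h * x * h⁻¹) ^ m = y ^ n →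
      (h * x⁻¹ * h⁻¹) ^ m = y⁻¹ ^ n := fun {x y h m n} hxy => by
    rw [inv_pow, ← hxy, ← conj_inv, inv_pow]
  have hpos : ∀ (i j : Fin k), i ≠ j → ∀ (h : Γ) (m n : ℕ), 0 < m → 0 < n →
      (h * g i * h⁻¹) ^ m ≠ g j ^ n := fun i j hij h m n hm hn hmn => by
    have h₁ := (hl i).smul_attracting_eq (hl j) hm hn hmn
    have h₂ := (hl i).inv.smul_attracting_eq (hl j).inv hm hn (hconj_inv hmn)
    have h₃ : e i = e j := horbit h (by rw [he₂, he₂, ← h₁, ← h₂]; rfl)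
    exact hij (by rw [← he₁ i, h₃, he₁ j])
  have hneg : ∀ (i j : Fin k) (h : Γ) (m n : ℕ), 0 < m → 0 < n →
      (h * g i * h⁻¹) ^ m ≠ (g j)⁻¹ ^ n := fun i j h m n hm hn hmn => by
    have h₁ := (hl i).smul_attracting_eq (hl j).inv hm hn hmn
    have h₂ := (hl i).inv.smul_attracting_eq (hl j) hm hn (by simpa using hconj_inv hmn)
    have h₃ : e i = (e j).swap := horbit h (by rw [he₂, he₃, ← h₁, ← h₂]; rfl)
    have h₄ : i = j := by
      rw [← he₁ i, h₃]
      refine Eq.trans ?_ (he₁ j)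
      cases e j <;> rfl
    subst h₄
    cases hei : e i <;> rw [hei] at h₃ <;> cases h₃
  choose φ hφ hφg hφ0 using fun i => (hl i).exists_isQuasimorphism hδ hΓ (hneg i i)
    (J := {j // j ≠ i}) (g' := fun j => g j) (fun j => hl j)
    (fun j => hpos i j j.2.symm) (fun j => hneg i j)
  choose r E hr hφr using hφg
  refine ⟨_, isQuasimorphism_sum hφ fun j => q j / r j, fun i => ?_⟩
  have hlim := (tendsto_div_of_abs_sub_mul_le (hφr i)).const_mul (q i / r i)
  rw [div_mul_cancel₀ _ (hr i)] at hlim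
  refine hlim.congr fun l => ?_
  rw [Finset.sum_eq_single i (fun j _ hji => by rw [hφ0 j ⟨i, hji.symm⟩, mul_zero]) (by simp),
    mul_div_assoc]
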